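/- Let $d\in\mathbb N$ and let $\mathcal N\subset\mathbb Z^d\setminus\{0\}$ be a finite set with $\mathcal N=-\mathcal N$ such that any two points of $\mathbb Z^d$ are joined by a finite path with increments in $\mathcal N$ (for example $\mathcal N=\{z\in\mathbb Z^d:|z|=1\}$). Let $(\Omega,\mathcal F,\mathbb P)$ be a probability space on which the group $\mathbb Z^d$ acts by measurable maps $(\tau_z)_{z\in\mathbb Z^d}$, and suppose that $\mathbb P$ is stationary and ergodic with respect to this action. For $x,y\in\mathbb Z^d$ let $c_{x,y}:\Omega\to[0,\infty)$ be measurable with $c_{x,y}=c_{y,x}$ and such that, for every $\xi\in\Omega$, $c_{x,y}(\xi)>0$ if and only if $y-x\in\mathcal N$. Suppose that $c_{x+z,y+z}(\xi)=c_{x,y}(\tau_z\xi)$ for all $x,y,z\in\mathbb Z^d$ and $\xi\in\Omega$, and that $\mathbb E[c_{0,z}]<\infty$ for all $z\in\mathcal N$. Let $L^2_R(\mathbb P)$ be the real Hilbert space of square integrable real functions. Consider $$\mathcal E(f,g):=\frac12\sum_{z\in\mathcal N}\mathbb E\big[c_{0,z}\,(f\circ\tau_z-f)(g\circ\tau_z-g)\big],\qquad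 f,g\in\mathcal D(\mathcal E),$$ $$\mathcal D(\mathcal E):=\Big\{f\in L^2_R(\mathbb P):\ \sum_{z\in\mathcal N}\mathbb E\big[c_{0,z}\,(f\circ\tau_z-f)^2\big]<\infty\Big\},$$ and $\|f\|_1:=(\|f\|_{L^2(\mathbb P)}^2+\mathcal E(f,f))^{1/2}$ on $\mathcal D(\mathcal E)$. 1. The expectations defining $\mathcal E$ on $\mathcal D(\mathcal E)$ exist and $\mathcal E$ is a Dirichlet form: $\mathcal D(\mathcal E)$ is a dense linear subspace of $L^2_R(\mathbb P)$; $\mathcal E$ is bilinear, symmetric and positive semidefinite on it; $\mathcal D(\mathcal E)$ is complete for $\|\cdot\|_1$; and if $u\in\mathcal D(\mathcal E)$ and $v:\Omega\to\mathbb R$ is a normal contraction of (a version of) $u$, i.e. $|v(\xi)-v(\xi')|\le|u(\xi)-u(\xi')|$ and $|v(\xi)|\le|u(\xi)|$ for all $\xi,\xi'\in\Omega$, then $v\in\mathcal D(\mathcal E)$ and $\mathcal E(v,v)\le\mathcal E(u,u)$. 2. The bounded measurable functions form a core of $\mathcal E$, i.e. a subset of $\mathcal D(\mathcal E)$ that is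 dense for $\|\cdot\|_1$. 3. There is a unique negative semidefinite self-adjoint operator $\mathbb L:\mathcal D(\mathbb L)\to L^2_R(\mathbb P)$, $\mathcal D(\mathbb L)\subset L^2_R(\mathbb P)$, such that $$\mathcal D(\mathcal E)=\mathcal D(\sqrt{-\mathbb L}),\qquad \|\sqrt{-\mathbb L}\,f\|_{L^2(\mathbb P)}^2=\mathcal E(f,f)\quad\text{for all } f\in\mathcal D(\mathcal E),$$ where $\sqrt{-\mathbb L}$ is the positive semidefinite self-adjoint square root of $-\mathbb L$. 4. If $f\in L^2_R(\mathbb P)$ is such that $c_{0,z}\,(f\circ\tau_z-f)\in L^1(\mathbb P)$ for every $z\in\mathcal N$ and $Lf:=\sum_{z\in\mathcal N}c_{0,z}\,(f\circ\tau_z-f)\in L^2(\mathbb P)$, then $f\in\mathcal D(\mathbb L)$ and $\mathbb Lf=Lf$. 5. In particular, if $\mathbb E[c_{0,z}^2]<\infty$ for all $z\in\mathcal N$, then every bounded measurable function $f:\Omega\to\mathbb R$ belongs to $\mathcal D(\mathbb L)$ and $\mathbb Lf=Lf$. -/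

import Mathlib

open MeasureTheory Filter

noncomputable section

/-! ### Symmetric forms, closedness, Dirichlet forms -/

section Forms

variable {H : Type*} [NormedAddCommGroup H] [InnerProductSpace ℝ H]

/-- `E` is a symmetric form on the real Hilbert space `H` with domain `D`: `D` is a dense linear
subspace, and `E` is bilinear, symmetric and positive semidefinite on `D`
(the values of `E` off `D` are irrelevant). -/
structure IsSymmetricForm (D : Set H) (E : H → H → ℝ) : Prop where
  zero_mem : (0 : H) ∈ D
  add_mem : ∀ f ∈ D, ∀ g ∈ D, f + g ∈ D
  smul_mem : ∀ (a : ℝ), ∀ f ∈ D, a • f ∈ D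
  dense : Dense D
  add_left : ∀ f ∈ D, ∀ g ∈ D, ∀ h ∈ D, E (f + g) h = E f h + E g h
  smul_left : ∀ (a : ℝ), ∀ f ∈ D, ∀ h ∈ D, E (a • f) h = a * E f h
  symm : ∀ f ∈ D, ∀ g ∈ D, E f g = E g f
  nonneg : ∀ f ∈ D, 0 ≤ E f f

/-- The form norm `‖f‖₁ = (‖f‖² + E(f,f))^{1/2}`. -/
def formNorm (E : H → H → ℝ) (f : H) : ℝ := Real.sqrt (‖f‖ ^ 2 + E f f)

/-- The form `(D, E)` is closed: `D` is complete with respect to the form norm. -/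
def IsClosedForm (D : Set H) (E : H → H → ℝ) : Prop :=
  ∀ u : ℕ → H, (∀ n, u n ∈ D) →
    (∀ ε > 0, ∃ n₀, ∀ m ≥ n₀, ∀ n ≥ n₀, formNorm E (u m - u n) < ε) →
    ∃ f ∈ D, Tendsto (fun n => formNorm E (u n - f)) atTop (nhds 0)

/-- `V` is a core of the form `(D, E)`: a subset of `D` that is dense for the form norm. -/
def IsFormCore (V D : Set H) (E : H → H → ℝ) : Prop :=
  V ⊆ D ∧ ∀ f ∈ D, ∀ ε > 0, ∃ g ∈ V, formNorm E (f - g) < ε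

end Forms

/-- The function `v` is a normal contraction of the function `u`. -/
def IsNormalContraction {Ω : Type*} (v u : Ω → ℝ) : Prop :=
  (∀ ξ ξ', |v ξ - v ξ'| ≤ |u ξ - u ξ'|) ∧ ∀ ξ, |v ξ| ≤ |u ξ|

/-- The Markovian property of a form on real `L²`: normal contractions (of any version `u'`) of
elements `u` of the domain are in the domain, and do not increase the energy. -/
def IsMarkovianForm {Ω : Type*} [MeasurableSpace Ω] {P : Measure Ω}
    (D : Set (Lp ℝ 2 P)) (E : Lp ℝ 2 P → Lp ℝ 2 P → ℝ) : Prop :=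
  ∀ u ∈ D, ∀ u' v' : Ω → ℝ, u' =ᵐ[P] u → IsNormalContraction v' u' →
    ∃ v ∈ D, v =ᵐ[P] v' ∧ E v v ≤ E u u

/-- A Dirichlet form: a closed symmetric form with the Markovian property. -/
structure IsDirichletForm {Ω : Type*} [MeasurableSpace Ω] {P : Measure Ω}
    (D : Set (Lp ℝ 2 P)) (E : Lp ℝ 2 P → Lp ℝ 2 P → ℝ) : Prop where
  symmetric : IsSymmetricForm D E
  closed : IsClosedForm D E
  markovian : IsMarkovianForm D E

/-- The (classes of) bounded measurable functions. -/
def boundedMeasurable {Ω : Type*} [MeasurableSpace Ω] (P : Measure Ω) : Set (Lp ℝ 2 P) :=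
  {f | ∃ g : Ω → ℝ, Measurable g ∧ (∃ C : ℝ, ∀ ξ, |g ξ| ≤ C) ∧ f =ᵐ[P] g}

/-! ### Unbounded operators -/

section Operators

variable {H : Type*} [NormedAddCommGroup H] [InnerProductSpace ℝ H] [CompleteSpace H]

/-- `S` is the square root `√A` of the nonnegative self-adjoint operator `A`: it is
self-adjoint, positive semidefinite, and `S ∘ S = A`, with `S ∘ S` on its natural domain
`{f ∈ D(S) | S f ∈ D(S)}` (equality of graphs). -/
structure IsNonnegSqrt (S A : H →ₗ.[ℝ] H) : Prop where
  selfAdjoint : IsSelfAdjoint S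
  nonneg : ∀ f : S.domain, 0 ≤ inner ℝ (S f) (f : H)
  sq : ∀ f g : H, (f, g) ∈ A.graph ↔ ∃ h, (f, h) ∈ S.graph ∧ (h, g) ∈ S.graph

/-- `L` is a negative semidefinite self-adjoint operator with `D(E) = D(√(-L))` and
`‖√(-L) f‖² = E(f,f)` for `f ∈ D(E)`. -/
structure IsFormGenerator (D : Set H) (E : H → H → ℝ) (L : H →ₗ.[ℝ] H) : Prop where
  selfAdjoint : IsSelfAdjoint L
  nonpos : ∀ f : L.domain, inner ℝ (L f) (f : H) ≤ 0
  sqrt : ∃ S : H →ₗ.[ℝ] H, IsNonnegSqrt S (-L) ∧ (S.domain : Set H) = D ∧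
    ∀ f : S.domain, ‖S f‖ ^ 2 = E f f

end Operators

/-! ### The random conductance model -/

/-- A finite set `N ⊆ ℤᵈ ∖ {0}` is a good neighbourhood of the origin if it is symmetric and any
two points are joined by a path with increments in `N`. -/
structure IsGoodNeighbourhood {d : ℕ} (N : Finset (Fin d → ℤ)) : Prop where
  zero_notMem : (0 : Fin d → ℤ) ∉ N
  symm : ∀ z ∈ N, -z ∈ N
  connected : ∀ x y : Fin d → ℤ, x ≠ y → Relation.ReflTransGen (fun a b => b - a ∈ N) x y

/-- `c x y` are random symmetric nonnegative conductances, positive exactly between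
neighbours (`y - x ∈ N`). -/
structure IsConductanceField {d : ℕ} {Ω : Type*} [MeasurableSpace Ω] (N : Finset (Fin d → ℤ))
    (c : (Fin d → ℤ) → (Fin d → ℤ) → Ω → ℝ) : Prop where
  measurable : ∀ x y, Measurable (c x y)
  nonneg : ∀ x y ξ, 0 ≤ c x y ξ
  pos_iff : ∀ x y ξ, 0 < c x y ξ ↔ y - x ∈ N
  symm : ∀ x y ξ, c x y ξ = c y x ξ

section Model

variable {d : ℕ} {Ω : Type*} [MeasurableSpace Ω] [AddAction (Fin d → ℤ) Ω]

/-- `D(E)`: the `f` in real `L²(P)` with `∑_{z ∈ N} E[c_{0,z} (f ∘ τ_z - f)²] < ∞`. -/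
def energyDomain (P : Measure Ω) (N : Finset (Fin d → ℤ))
    (c : (Fin d → ℤ) → (Fin d → ℤ) → Ω → ℝ) : Set (Lp ℝ 2 P) :=
  {f | ∑ z ∈ N, ∫⁻ ξ, ENNReal.ofReal (c 0 z ξ * (f (z +ᵥ ξ) - f ξ) ^ 2) ∂P < ⊤}

/-- `E(f,g) = ½ ∑_{z ∈ N} E[c_{0,z} (f ∘ τ_z - f) (g ∘ τ_z - g)]`. -/
def energyForm (P : Measure Ω) (N : Finset (Fin d → ℤ))
    (c : (Fin d → ℤ) → (Fin d → ℤ) → Ω → ℝ) (f g : Lp ℝ 2 P) : ℝ :=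
  (1 / 2) * ∑ z ∈ N, ∫ ξ, c 0 z ξ * (f (z +ᵥ ξ) - f ξ) * (g (z +ᵥ ξ) - g ξ) ∂P

/-- `L f = ∑_{z ∈ N} c_{0,z} (f ∘ τ_z - f)`, as a function on the environment space. -/
def pointGenerator (N : Finset (Fin d → ℤ)) (c : (Fin d → ℤ) → (Fin d → ℤ) → Ω → ℝ)
    (f : Ω → ℝ) (ξ : Ω) : ℝ :=
  ∑ z ∈ N, c 0 z ξ * (f (z +ᵥ ξ) - f ξ)

end Model

end

/-!
The generator of a closed form. The domain of a closed form `E` on a real Hilbert space `H` is a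
Hilbert space for `⟪f, g⟫ + E(f, g)`. If `j` is its inclusion into `H`, then `B = j j†` is the
resolvent at `1` of the operator `-L` to be constructed, so `-L = (1 - B) B⁻¹`, and with
`T = √B`, `R = √(1 - B)` the square root of `-L` is `R T⁻¹`. As only bounded operators between `0`
and `1` need square roots, no spectral theory is used: in a Banach algebra the iteration
`y ↦ (x + y²) / 2` converges in norm for `‖x‖ ≤ 1`, being dominated by the same iteration for
`x = 1` in `ℝ`, and its limit satisfies `(1 - y)² = 1 - x` (`exists_sqrt_of_norm_one_sub_le`). The operators
`-L` and `√(-L)` have graphs of the form `{(P x, Q x)}`, for which self-adjointness is an algebraic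
statement (`isSelfAdjoint_graphOperator`); that `D(√(-L)) = range T` is the domain of the form
follows from `‖T x‖ = ‖j† x‖` (`exists_isFormGenerator`). Conversely the form determines the graph
of any generator: `L f = g` if and only if `E(f, ·) = -⟪g, ·⟫` on the domain
(`IsFormGenerator.mem_graph_iff`), which gives uniqueness.

The energy form. Closedness is Fatou's lemma along an almost everywhere convergent subsequence
(`energy_le_of_tendsto`); the Markovian property is a pointwise comparison of gradients; and
truncations show by dominated convergence that the bounded functions form a core.

The pointwise generator `Lf = ∑ c_{0,z} (f ∘ τ_z - f)`. Stationarity gives `E(f, k) = -⟪Lf, k⟫` for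
bounded `k` (`energyForm_eq_neg_integral_pointGenerator`). Applied to truncations of `f` and
combined with Fatou's lemma, it shows that `f` has finite energy as soon as `Lf` is square integrable
(`mem_energyDomain_of_memLp_pointGenerator`); since bounded functions form a core, the identity
extends to all `k` in the domain, and the characterization of the graph identifies `Lf` with the
self-adjoint generator.
-/

/-! ### Square roots in Banach algebras -/

/-- The iteration `y ↦ (x + y²) / 2`, started at `0`, whose limit `y` satisfies
`(1 - y)² = 1 - x`. -/
noncomputable def sqrtIter {A : Type*} [NormedRing A] [NormedAlgebra ℝ A] (x : A) : ℕ → A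
  | 0 => 0
  | n + 1 => (2⁻¹ : ℝ) • (x + sqrtIter x n * sqrtIter x n)

lemma sqrtIter_one_le (n : ℕ) : 0 ≤ sqrtIter (1 : ℝ) n ∧ sqrtIter (1 : ℝ) n ≤ 1 := by
  induction n with
  | zero => simp [sqrtIter]
  | succ n ih =>
    simp only [sqrtIter, smul_eq_mul]
    constructor <;> nlinarith [ih.1, ih.2]

/-- The iteration for `x = 1` in `ℝ` dominates the one for any `x` in the unit ball. -/
lemma norm_sqrtIter_le {A : Type*} [NormedRing A] [NormedAlgebra ℝ A] {x : A} (hx : ‖x‖ ≤ 1)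
    (n : ℕ) : ‖sqrtIter x n‖ ≤ sqrtIter (1 : ℝ) n := by
  induction n with
  | zero => simp [sqrtIter]
  | succ n ih =>
    have h0 := (sqrtIter_one_le n).1
    simp only [sqrtIter, smul_eq_mul, norm_smul]
    have h1 := norm_add_le x (sqrtIter x n * sqrtIter x n)
    have h2 := norm_mul_le (sqrtIter x n) (sqrtIter x n)
    have h3 := mul_le_mul ih ih (norm_nonneg _) h0
    rw [show ‖(2⁻¹ : ℝ)‖ = 2⁻¹ by norm_num]
    linarith

lemma norm_sqrtIter_succ_sub_le {A : Type*} [NormedRing A] [NormedAlgebra ℝ A] {x : A}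
    (hx : ‖x‖ ≤ 1) (n : ℕ) :
    ‖sqrtIter x (n + 1) - sqrtIter x n‖ ≤ sqrtIter (1 : ℝ) (n + 1) - sqrtIter (1 : ℝ) n := by
  induction n with
  | zero =>
    have e : sqrtIter x 1 - sqrtIter x 0 = (2⁻¹ : ℝ) • x := by simp [sqrtIter]
    rw [e, norm_smul, show ‖(2⁻¹ : ℝ)‖ = 2⁻¹ by norm_num]
    simp only [sqrtIter, smul_eq_mul]
    linarith
  | succ n ih =>
    have e : ∀ {B : Type _} [NormedRing B] [NormedAlgebra ℝ B] (x : B),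
        sqrtIter x (n + 1 + 1) - sqrtIter x (n + 1) =
        (2⁻¹ : ℝ) • (sqrtIter x (n + 1) * (sqrtIter x (n + 1) - sqrtIter x n)
          + (sqrtIter x (n + 1) - sqrtIter x n) * sqrtIter x n) := by
      intro B _ _ x
      rw [sqrtIter]
      conv_lhs => rw [show sqrtIter x (n + 1) = (2⁻¹ : ℝ) • (x + sqrtIter x n * sqrtIter x n)
        from rfl]
      rw [← smul_sub, ← show sqrtIter x (n + 1) = (2⁻¹ : ℝ) • (x + sqrtIter x n * sqrtIter x n)
        from rfl]
      congr 1
      noncomm_ring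
    have e1 : sqrtIter (1 : ℝ) (n + 1 + 1) - sqrtIter (1 : ℝ) (n + 1) =
        2⁻¹ * (sqrtIter (1 : ℝ) (n + 1) * (sqrtIter (1 : ℝ) (n + 1) - sqrtIter (1 : ℝ) n)
          + (sqrtIter (1 : ℝ) (n + 1) - sqrtIter (1 : ℝ) n) * sqrtIter (1 : ℝ) n) := by
      simp only [sqrtIter, smul_eq_mul]
      ring
    rw [e, e1, norm_smul, show ‖(2⁻¹ : ℝ)‖ = 2⁻¹ by norm_num]
    have d0 := (norm_nonneg _).trans ih
    have h1 := (norm_mul_le (sqrtIter x (n + 1)) (sqrtIter x (n + 1) - sqrtIter x n)).trans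
      (mul_le_mul (norm_sqrtIter_le hx (n + 1)) ih (norm_nonneg _) (sqrtIter_one_le _).1)
    have h2 := (norm_mul_le (sqrtIter x (n + 1) - sqrtIter x n) (sqrtIter x n)).trans
      (mul_le_mul ih (norm_sqrtIter_le hx n) (norm_nonneg _) d0)
    have h3 := norm_add_le (sqrtIter x (n + 1) * (sqrtIter x (n + 1) - sqrtIter x n))
      ((sqrtIter x (n + 1) - sqrtIter x n) * sqrtIter x n)
    linarith

lemma cauchySeq_sqrtIter {A : Type*} [NormedRing A] [NormedAlgebra ℝ A] {x : A} (hx : ‖x‖ ≤ 1) :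
    CauchySeq (sqrtIter x) := by
  refine cauchySeq_of_summable_dist
    (Summable.of_nonneg_of_le (fun _ => dist_nonneg)
      (fun n => by rw [dist_comm, dist_eq_norm]; exact norm_sqrtIter_succ_sub_le hx n)
      (summable_of_sum_range_le (c := 1)
        (fun n => (norm_nonneg _).trans (norm_sqrtIter_succ_sub_le hx n)) fun n => ?_))
  rw [Finset.sum_range_sub]
  simpa [sqrtIter] using (sqrtIter_one_le n).2

/-- A self-adjoint `b` with `‖1 - b‖ ≤ 1` has a self-adjoint square root `t` with `‖1 - t‖ ≤ 1`
in its bicommutant. -/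
theorem exists_sqrt_of_norm_one_sub_le {A : Type*} [NormedRing A] [NormedAlgebra ℝ A]
    [CompleteSpace A] [StarRing A] [ContinuousStar A] [StarModule ℝ A] {b : A}
    (hb : IsSelfAdjoint b) (hb1 : ‖1 - b‖ ≤ 1) :
    ∃ t : A, t * t = b ∧ IsSelfAdjoint t ∧ ‖1 - t‖ ≤ 1 ∧ ∀ z, Commute z b → Commute z t := by
  obtain ⟨y, hy⟩ := cauchySeq_tendsto_of_complete (cauchySeq_sqrtIter hb1)
  have hfix : y = (2⁻¹ : ℝ) • ((1 - b) + y * y) :=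
    tendsto_nhds_unique (hy.comp (tendsto_add_atTop_nat 1))
      (((hy.mul hy).const_add (1 - b)).const_smul (2⁻¹ : ℝ))
  have hfix2 : y + y = (1 - b) + y * y := by
    rw [← two_smul ℝ y]
    nth_rw 1 [hfix]
    rw [smul_smul]
    norm_num
  refine ⟨1 - y, ?_, ?_, ?_, fun z hz => ?_⟩
  · have : (1 - y) * (1 - y) = 1 - (y + y) + y * y := by noncomm_ring
    rw [this, hfix2]
    abel
  · refine (IsSelfAdjoint.one A).sub ?_
    have hn : ∀ n, IsSelfAdjoint (sqrtIter (1 - b) n) := fun n => by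
      induction n with
      | zero => exact IsSelfAdjoint.zero A
      | succ n ih =>
        refine IsSelfAdjoint.smul (IsSelfAdjoint.all _) (((IsSelfAdjoint.one A).sub hb).add ?_)
        rw [IsSelfAdjoint, star_mul, ih]
    exact tendsto_nhds_unique ((hy.star).congr hn) hy
  · rw [sub_sub_cancel]
    exact le_of_tendsto hy.norm
      (Eventually.of_forall fun n => (norm_sqrtIter_le hb1 n).trans (sqrtIter_one_le n).2)
  · refine (Commute.one_right z).sub_right ?_
    have hn : ∀ n, Commute z (sqrtIter (1 - b) n) := fun n => by
      induction n with
      | zero => exact Commute.zero_right z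
      | succ n ih =>
        exact ((((Commute.one_right z).sub_right hz)).add_right (ih.mul_right ih)).smul_right _
    exact tendsto_nhds_unique ((hy.const_mul z).congr hn) (hy.mul_const z)

/-! ### Operators whose graph is parametrized by two bounded operators -/

section GraphOperator

variable {H : Type*} [NormedAddCommGroup H] [InnerProductSpace ℝ H]

/-- The operator `Q P⁻¹` with graph `{(P x, Q x)}` (for injective `P`). -/
noncomputable def graphOperator (P Q : H →L[ℝ] H) : H →ₗ.[ℝ] H :=
  (LinearMap.range (P.prod Q : H →ₗ[ℝ] H × H)).toLinearPMap

lemma mem_graph_graphOperator {P Q : H →L[ℝ] H} (hP : Function.Injective P) (f g : H) :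
    (f, g) ∈ (graphOperator P Q).graph ↔ ∃ x, P x = f ∧ Q x = g := by
  rw [graphOperator, Submodule.toLinearPMap_graph_eq]
  · simp
  · rintro ⟨a, b⟩ ⟨x, hx⟩ (h : a = 0)
    simp only [ContinuousLinearMap.coe_coe, ContinuousLinearMap.prod_apply, Prod.mk.injEq] at hx
    have : x = 0 := hP (by rw [hx.1, h, map_zero])
    rw [← hx.2, this, map_zero]

lemma mem_domain_graphOperator {P Q : H →L[ℝ] H} (hP : Function.Injective P) (f : H) :
    f ∈ (graphOperator P Q).domain ↔ ∃ x, P x = f := by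
  rw [LinearPMap.mem_domain_iff]
  simp [mem_graph_graphOperator hP]

lemma exists_eq_graphOperator_apply {P Q : H →L[ℝ] H} (hP : Function.Injective P)
    (f : (graphOperator P Q).domain) : ∃ x, P x = f ∧ Q x = graphOperator P Q f :=
  (mem_graph_graphOperator hP _ _).1 (LinearPMap.mem_graph _ f)

variable [CompleteSpace H]

lemma denseRange_of_isSelfAdjoint {P : H →L[ℝ] H} (hP : IsSelfAdjoint P)
    (hinj : Function.Injective P) : DenseRange P := by
  have : (LinearMap.range (P : H →ₗ[ℝ] H)).topologicalClosure = ⊤ := by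
    rw [Submodule.topologicalClosure_eq_top_iff, Submodule.eq_bot_iff]
    intro v hv
    apply hinj
    rw [map_zero, ← inner_self_eq_zero (𝕜 := ℝ)]
    have h := (Submodule.mem_orthogonal _ _).1 hv (P (P v)) ⟨P v, rfl⟩
    rwa [← ContinuousLinearMap.adjoint_inner_right, ← ContinuousLinearMap.star_eq_adjoint,
      hP.star_eq] at h
  exact Submodule.dense_iff_topologicalClosure_eq_top.2 this

/-- `Q P⁻¹` is self-adjoint if `P` and `Q` are commuting self-adjoint operators and every solution
of `P v = Q u` is of the form `(u, v) = (P x, Q x)`. -/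
theorem isSelfAdjoint_graphOperator {P Q : H →L[ℝ] H} (hinj : Function.Injective P)
    (hP : IsSelfAdjoint P) (hQ : IsSelfAdjoint Q) (hPQ : Commute P Q)
    (hsolve : ∀ u v, P v = Q u → ∃ x, P x = u ∧ Q x = v) :
    IsSelfAdjoint (graphOperator P Q) := by
  have sP : ∀ x y, inner ℝ (P x) y = inner ℝ x (P y) := hP.isSymmetric
  have sQ : ∀ x y, inner ℝ (Q x) y = inner ℝ x (Q y) := hQ.isSymmetric
  have hd : Dense ((graphOperator P Q).domain : Set H) := by
    have : ((graphOperator P Q).domain : Set H) = Set.range P := by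
      ext f
      exact mem_domain_graphOperator hinj f
    rw [this]
    exact denseRange_of_isSelfAdjoint hP hinj
  rw [LinearPMap.isSelfAdjoint_def]
  apply LinearPMap.eq_of_eq_graph
  rw [LinearPMap.adjoint_graph_eq_graph_adjoint hd]
  ext ⟨u, v⟩
  simp only [Submodule.mem_adjoint_iff, mem_graph_graphOperator hinj]
  constructor
  · intro h
    refine hsolve u v (ext_inner_left ℝ fun x => ?_)
    have := h (P x) (Q x) ⟨x, rfl, rfl⟩
    rw [sP, sQ] at this
    linarith
  · rintro ⟨x, rfl, rfl⟩ _ _ ⟨y, rfl, rfl⟩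
    rw [sP, sQ, sub_eq_zero]
    congr 1
    exact (DFunLike.congr_fun hPQ.eq x).symm

end GraphOperator

/-! ### The Hilbert space of a closed form -/

section FormSpace

variable {H : Type*} [NormedAddCommGroup H] [InnerProductSpace ℝ H] {D : Set H} {E : H → H → ℝ}

/-- The domain of a symmetric form, as a linear subspace. -/
def IsSymmetricForm.domain (h : IsSymmetricForm D E) : Submodule ℝ H where
  carrier := D
  zero_mem' := h.zero_mem
  add_mem' hf hg := h.add_mem _ hf _ hg
  smul_mem' a _ hf := h.smul_mem a _ hf

lemma IsSymmetricForm.sub_mem (h : IsSymmetricForm D E) {f g : H} (hf : f ∈ D) (hg : g ∈ D) :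
    f - g ∈ D :=
  h.domain.sub_mem hf hg

lemma IsSymmetricForm.add_right (h : IsSymmetricForm D E) {f g k : H} (hf : f ∈ D) (hg : g ∈ D)
    (hk : k ∈ D) : E f (g + k) = E f g + E f k := by
  rw [h.symm f hf _ (h.add_mem g hg k hk), h.add_left g hg k hk f hf, h.symm g hg f hf,
    h.symm k hk f hf]

/-- The domain of a symmetric form, as a type of its own: it carries the inner product
`⟪f, g⟫ + E(f, g)` instead of the one inherited from `H`. -/
def IsSymmetricForm.Space (h : IsSymmetricForm D E) : Type _ := h.domain

namespace IsSymmetricForm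

variable (h : IsSymmetricForm D E)

noncomputable instance : AddCommGroup h.Space := inferInstanceAs (AddCommGroup h.domain)

noncomputable instance : Module ℝ h.Space := inferInstanceAs (Module ℝ h.domain)

/-- The inclusion of the domain into the ambient space. -/
def inclₗ : h.Space →ₗ[ℝ] H := h.domain.subtype

lemma inclₗ_mem (f : h.Space) : h.inclₗ f ∈ D := Subtype.property (p := (· ∈ h.domain)) f

lemma inclₗ_injective : Function.Injective h.inclₗ := Subtype.val_injective

lemma exists_inclₗ_eq {f : H} (hf : f ∈ D) : ∃ w, h.inclₗ w = f := ⟨⟨f, hf⟩, rfl⟩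

/-- The inner product `⟪f, g⟫ + E(f, g)` on the domain of a symmetric form. -/
@[reducible] noncomputable def core : InnerProductSpace.Core ℝ h.Space where
  inner f g := inner ℝ (h.inclₗ f) (h.inclₗ g) + E (h.inclₗ f) (h.inclₗ g)
  conj_inner_symm f g := by
    simp only [conj_trivial]
    rw [real_inner_comm, h.symm _ (h.inclₗ_mem g) _ (h.inclₗ_mem f)]
  re_inner_nonneg f := add_nonneg (real_inner_self_nonneg) (h.nonneg _ (h.inclₗ_mem f))
  add_left f g k := by
    rw [map_add, inner_add_left, h.add_left _ (h.inclₗ_mem f) _ (h.inclₗ_mem g) _ (h.inclₗ_mem k)]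
    ring
  smul_left f g a := by
    rw [map_smul, real_inner_smul_left, h.smul_left _ _ (h.inclₗ_mem f) _ (h.inclₗ_mem g)]
    simp only [conj_trivial]
    ring
  definite f hf := by
    have h1 := h.nonneg _ (h.inclₗ_mem f)
    have h2 : inner ℝ (h.inclₗ f) (h.inclₗ f) = (0 : ℝ) := by
      have := real_inner_self_nonneg (x := h.inclₗ f)
      linarith
    exact h.inclₗ_injective (by rw [inner_self_eq_zero.1 h2, map_zero])

noncomputable instance : NormedAddCommGroup h.Space := h.core.toNormedAddCommGroup

noncomputable instance : InnerProductSpace ℝ h.Space := InnerProductSpace.ofCore h.core.toCore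

lemma inner_space (f g : h.Space) :
    inner ℝ f g = inner ℝ (h.inclₗ f) (h.inclₗ g) + E (h.inclₗ f) (h.inclₗ g) := rfl

lemma norm_space_sq (f : h.Space) : ‖f‖ ^ 2 = ‖h.inclₗ f‖ ^ 2 + E (h.inclₗ f) (h.inclₗ f) := by
  rw [← real_inner_self_eq_norm_sq, inner_space, real_inner_self_eq_norm_sq]

lemma norm_space (f : h.Space) : ‖f‖ = formNorm E (h.inclₗ f) := by
  rw [formNorm, ← norm_space_sq, Real.sqrt_sq (norm_nonneg f)]

lemma norm_inclₗ_le (f : h.Space) : ‖h.inclₗ f‖ ≤ ‖f‖ :=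
  le_of_sq_le_sq (by rw [norm_space_sq]; linarith [h.nonneg _ (h.inclₗ_mem f)]) (norm_nonneg f)

/-- The inclusion of the Hilbert space of the form into the ambient space, as a bounded
operator. -/
noncomputable def incl : h.Space →L[ℝ] H :=
  h.inclₗ.mkContinuous 1 fun f => by rw [one_mul]; exact h.norm_inclₗ_le f

lemma incl_apply (f : h.Space) : h.incl f = h.inclₗ f := rfl

lemma completeSpace (hcl : IsClosedForm D E) : CompleteSpace h.Space := by
  refine Metric.complete_of_cauchySeq_tendsto fun u hu => ?_
  obtain ⟨f, hf, hlim⟩ := hcl (fun n => h.inclₗ (u n)) (fun n => h.inclₗ_mem _) fun ε hε => by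
    obtain ⟨n₀, hn⟩ := Metric.cauchySeq_iff.1 hu ε hε
    refine ⟨n₀, fun m hm n hn' => ?_⟩
    rw [← map_sub, ← norm_space, ← dist_eq_norm]
    exact hn m hm n hn'
  obtain ⟨w, rfl⟩ := h.exists_inclₗ_eq hf
  refine ⟨w, tendsto_iff_norm_sub_tendsto_zero.2 (hlim.congr fun n => ?_)⟩
  rw [← map_sub, ← norm_space]

end IsSymmetricForm

/-- An identity `E(f, ·) = -⟪g, ·⟫` extends from a core to the whole domain, as both sides are
continuous for the form norm. -/
lemma IsFormCore.eq_neg_inner {V : Set H} (hV : IsFormCore V D E) (hs : IsSymmetricForm D E)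
    {f g : H} (hf : f ∈ D) (h : ∀ k ∈ V, E f k = -inner ℝ g k) :
    ∀ k ∈ D, E f k = -inner ℝ g k := by
  intro k hk
  obtain ⟨f, rfl⟩ := hs.exists_inclₗ_eq hf
  obtain ⟨w, rfl⟩ := hs.exists_inclₗ_eq hk
  have hcl : IsClosed {w : hs.Space | inner ℝ f w - inner ℝ (hs.incl f) (hs.incl w) =
      -inner ℝ g (hs.incl w)} := isClosed_eq (by fun_prop) (by fun_prop)
  have hsub : {w : hs.Space | hs.inclₗ w ∈ V} ⊆ {w : hs.Space |
      inner ℝ f w - inner ℝ (hs.incl f) (hs.incl w) = -inner ℝ g (hs.incl w)} := fun w hw => by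
    rw [Set.mem_ofPred_eq, hs.inner_space, hs.incl_apply, hs.incl_apply, add_sub_cancel_left]
    exact h _ hw
  have hmem : w ∈ closure {w : hs.Space | hs.inclₗ w ∈ V} := by
    refine Metric.mem_closure_iff.2 fun ε hε => ?_
    obtain ⟨b, hb, hlt⟩ := hV.2 _ hk ε hε
    obtain ⟨b, rfl⟩ := hs.exists_inclₗ_eq (hV.1 hb)
    refine ⟨b, hb, ?_⟩
    rw [dist_eq_norm, hs.norm_space, map_sub]
    exact hlt
  have := hcl.closure_subset_iff.2 hsub hmem
  rwa [Set.mem_ofPred_eq, hs.inner_space, hs.incl_apply, hs.incl_apply,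
    add_sub_cancel_left] at this

end FormSpace

/-! ### The generator of a closed form -/

/-- If `A` and `C` satisfy `‖A h‖ = ‖C h‖` and `A` has dense range, then the isometry
`A h ↦ C h` extends to the whole space by continuity. -/
lemma exists_tendsto_of_norm_eq {H X Y : Type*} [NormedAddCommGroup H] [NormedSpace ℝ H]
    [NormedAddCommGroup X] [NormedSpace ℝ X] [NormedAddCommGroup Y] [NormedSpace ℝ Y]
    [CompleteSpace Y] (A : H →L[ℝ] X) (C : H →L[ℝ] Y) (hAC : ∀ y, ‖A y‖ = ‖C y‖)
    (hA : DenseRange A) (x : X) :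
    ∃ y : Y, ‖y‖ = ‖x‖ ∧ ∃ u : ℕ → H, Tendsto (fun n => A (u n)) atTop (nhds x) ∧
      Tendsto (fun n => C (u n)) atTop (nhds y) := by
  obtain ⟨v, hv, hlim⟩ := mem_closure_iff_seq_limit.1 (hA x)
  choose u hu using hv
  obtain rfl : (fun n => A (u n)) = v := funext hu
  have hc : CauchySeq fun n => C (u n) := by
    rw [Metric.cauchySeq_iff]
    intro ε hε
    obtain ⟨n₀, hn⟩ := Metric.cauchySeq_iff.1 hlim.cauchySeq ε hε
    refine ⟨n₀, fun m hm n hn' => ?_⟩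
    rw [dist_eq_norm, ← map_sub, ← hAC, map_sub, ← dist_eq_norm]
    exact hn m hm n hn'
  obtain ⟨y, hy⟩ := cauchySeq_tendsto_of_complete hc
  refine ⟨y, ?_, u, hlim, hy⟩
  exact tendsto_nhds_unique (hy.norm.congr fun n => (hAC _).symm) hlim.norm

section Generator

variable {H : Type*} [NormedAddCommGroup H] [InnerProductSpace ℝ H] [CompleteSpace H]
  {D : Set H} {E : H → H → ℝ}

/-- The graph of a generator is determined by the form: `L f = g` if and only if `f ∈ D` and
`E(f, ·) = -⟪g, ·⟫` on `D`. -/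
theorem IsFormGenerator.mem_graph_iff {L : H →ₗ.[ℝ] H} (hs : IsSymmetricForm D E)
    (hL : IsFormGenerator D E L) (f g : H) :
    (f, g) ∈ L.graph ↔ f ∈ D ∧ ∀ k ∈ D, E f k = -inner ℝ g k := by
  obtain ⟨S, hS, hdom, hnorm⟩ := hL.sqrt
  have hpol : ∀ a b : S.domain, inner ℝ (S a) (S b) = E a b := fun a b => by
    have hm : ∀ a : S.domain, (a : H) ∈ D := fun a => by rw [← hdom]; exact a.2
    have h1 := norm_add_sq_real (S a) (S b)
    rw [← LinearPMap.map_add, hnorm, hnorm, hnorm, Submodule.coe_add,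
      hs.add_left _ (hm a) _ (hm b) _ (hs.add_mem _ (hm a) _ (hm b)),
      hs.add_right (hm a) (hm a) (hm b), hs.add_right (hm b) (hm a) (hm b),
      hs.symm _ (hm b) _ (hm a)] at h1
    linarith
  have hself : ∀ p : H × H, p ∈ S.graph ↔ ∀ a b, (a, b) ∈ S.graph →
      inner ℝ b p.1 - inner ℝ a p.2 = 0 := fun p => by
    rw [← Submodule.mem_adjoint_iff, ← LinearPMap.adjoint_graph_eq_graph_adjoint
      hS.selfAdjoint.dense_domain, LinearPMap.isSelfAdjoint_def.1 hS.selfAdjoint]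
  have hneg : (f, g) ∈ L.graph ↔ (f, -g) ∈ (-L).graph := by
    simp only [LinearPMap.mem_graph_iff, LinearPMap.neg_apply, neg_inj]
    rfl
  rw [hneg, hS.sq]
  constructor
  · rintro ⟨k, hk, hk'⟩
    obtain ⟨f', rfl, rfl⟩ := (LinearPMap.mem_graph_iff S).1 hk
    refine ⟨by rw [← hdom]; exact f'.2, fun a ha => ?_⟩
    rw [← hdom] at ha
    have h1 := (hself _).1 hk' a (S ⟨a, ha⟩) (LinearPMap.mem_graph S ⟨a, ha⟩)
    have h2 := hpol f' ⟨a, ha⟩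
    rw [real_inner_comm] at h2
    simp only [inner_neg_right] at h1
    rw [← h2, real_inner_comm a g]
    linarith
  · rintro ⟨hf, h⟩
    rw [← hdom] at hf
    refine ⟨S ⟨f, hf⟩, LinearPMap.mem_graph S ⟨f, hf⟩, (hself _).2 fun a b hab => ?_⟩
    obtain ⟨a', rfl, rfl⟩ := (LinearPMap.mem_graph_iff S).1 hab
    have h1 := h a' (by rw [← hdom]; exact a'.2)
    have h2 := hpol ⟨f, hf⟩ a'
    rw [real_inner_comm] at h2
    simp only [inner_neg_right]
    rw [real_inner_comm g, h2, h1]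
    ring

theorem IsFormGenerator.eq {L L' : H →ₗ.[ℝ] H} (hs : IsSymmetricForm D E)
    (hL : IsFormGenerator D E L) (hL' : IsFormGenerator D E L') : L' = L := by
  apply LinearPMap.eq_of_eq_graph
  ext ⟨f, g⟩
  rw [hL.mem_graph_iff hs, hL'.mem_graph_iff hs]

/-- Every closed form has a generator. If `j` is the inclusion of the Hilbert space of the form,
then `B = j j†` is the resolvent `(1 - L)⁻¹`, so that with `T = √B` and `R = √(1 - B)` the
operators `-L = (1 - B) B⁻¹` and `√(-L) = R T⁻¹` have the graphs `{(B x, (1 - B) x)}` and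
`{(T x, R x)}`. -/
theorem exists_isFormGenerator (hs : IsSymmetricForm D E) (hcl : IsClosedForm D E) :
    ∃ L : H →ₗ.[ℝ] H, IsFormGenerator D E L := by
  have := hs.completeSpace hcl
  set j := hs.incl with hj
  have hjinj : Function.Injective j := hs.inclₗ_injective
  set G := j.adjoint with hG
  set B : H →L[ℝ] H := j ∘L G with hB
  have hBsa : IsSelfAdjoint B := by
    rw [IsSelfAdjoint, ContinuousLinearMap.star_eq_adjoint, hB,
      ContinuousLinearMap.adjoint_comp, hG, ContinuousLinearMap.adjoint_adjoint]
  have sym : ∀ {P : H →L[ℝ] H}, IsSelfAdjoint P → ∀ x y, inner ℝ (P x) y = inner ℝ x (P y) :=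
    fun hP => hP.isSymmetric
  have hGB : ∀ x, ‖G x‖ ^ 2 = inner ℝ x (B x) := fun x => by
    rw [← real_inner_self_eq_norm_sq, hG, ContinuousLinearMap.adjoint_inner_left]
    rfl
  have hBle : ∀ x, ‖B x‖ ^ 2 ≤ inner ℝ x (B x) := fun x => by
    rw [← hGB]
    gcongr
    exact hs.norm_inclₗ_le (G x)
  -- `‖B‖ ≤ 1` and `‖1 - B‖ ≤ 1` both follow from `B² ≤ B`, which is `hBle`
  have hBnorm : ‖1 - (1 - B)‖ ≤ 1 := by
    rw [sub_sub_cancel]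
    refine B.opNorm_le_bound zero_le_one fun x => ?_
    rw [one_mul]
    have h1 := (hBle x).trans (real_inner_le_norm x (B x))
    by_contra! hlt
    nlinarith [norm_nonneg x, norm_nonneg (B x)]
  have hBnorm' : ‖1 - B‖ ≤ 1 := by
    refine (1 - B).opNorm_le_bound zero_le_one fun x => ?_
    rw [one_mul]
    refine le_of_sq_le_sq ?_ (norm_nonneg x)
    change ‖x - B x‖ ^ 2 ≤ _
    rw [norm_sub_sq_real]
    have := hBle x
    have h2 : 0 ≤ ‖B x‖ ^ 2 := by positivity
    linarith
  have hinj_of_sq : ∀ {P : H →L[ℝ] H}, Function.Injective B → P * P = B → Function.Injective P :=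
    fun {P} hi hP => by
      intro x y hxy
      apply hi
      rw [← hP]
      change P (P x) = P (P y)
      rw [hxy]
  have hBinj : Function.Injective B := by
    rw [injective_iff_map_eq_zero]
    intro x hx
    have hGx : G x = 0 := by
      have := hGB x
      rw [hx, inner_zero_right] at this
      simpa using this
    refine hs.dense.eq_zero_of_inner_left ℝ fun f hf => ?_
    obtain ⟨w, rfl⟩ := hs.exists_inclₗ_eq hf
    have : inner ℝ (G x) w = inner ℝ x (j w) := ContinuousLinearMap.adjoint_inner_left _ _ _
    rw [hGx, inner_zero_left] at this
    exact this.symm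
  have h1Bsa : IsSelfAdjoint (1 - B) := (IsSelfAdjoint.one _).sub hBsa
  obtain ⟨T, hTT, hTsa, hT1, hTc⟩ := exists_sqrt_of_norm_one_sub_le hBsa hBnorm'
  obtain ⟨R, hRR, hRsa, hR1, hRc⟩ := exists_sqrt_of_norm_one_sub_le h1Bsa hBnorm
  obtain ⟨Q, hQQ, hQsa, -, hQc⟩ := exists_sqrt_of_norm_one_sub_le hTsa hT1
  have hTB : Commute T B := by rw [← hTT]; exact (Commute.refl T).mul_right (Commute.refl T)
  have hTR : Commute T R := hRc T ((Commute.one_right T).sub_right hTB)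
  have hRQ : Commute R Q := hQc R hTR.symm
  have hTinj : Function.Injective T := hinj_of_sq hBinj hTT
  have hTTx : ∀ x, T (T x) = B x := fun x => DFunLike.congr_fun hTT x
  have hRRx : ∀ x, R (R x) = x - B x := fun x => DFunLike.congr_fun hRR x
  have hTRx : ∀ x, T (R x) = R (T x) := fun x => DFunLike.congr_fun hTR.eq x
  have hRQx : ∀ x, R (Q x) = Q (R x) := fun x => DFunLike.congr_fun hRQ.eq x
  have hQQx : ∀ x, Q (Q x) = T x := fun x => DFunLike.congr_fun hQQ x
  have hsolveS : ∀ u v, T v = R u → ∃ x, T x = u ∧ R x = v := fun u v huv =>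
    ⟨T u + R v, by rw [map_add, hTTx, hTRx, huv, hRRx]; abel,
      by rw [map_add, ← hTRx, ← huv, hTTx, hRRx]; abel⟩
  have hsolveL : ∀ u v, B v = (B - 1) u → ∃ x, B x = u ∧ (B - 1) x = v := fun u v huv => by
    change B v = B u - u at huv
    refine ⟨u - v, by rw [map_sub, huv]; abel, ?_⟩
    change B (u - v) - (u - v) = v
    rw [map_sub, huv]
    abel
  -- `T` maps `H` isometrically onto the Hilbert space of the form
  have hnormG : ∀ x, ‖T x‖ = ‖G x‖ := fun x => by
    rw [← sq_eq_sq₀ (norm_nonneg _) (norm_nonneg _), hGB, ← real_inner_self_eq_norm_sq,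
      sym hTsa, hTTx]
  have hGdense : DenseRange G := by
    have : (LinearMap.range (G : H →ₗ[ℝ] hs.Space)).topologicalClosure = ⊤ := by
      rw [Submodule.topologicalClosure_eq_top_iff, Submodule.eq_bot_iff]
      intro w hw
      apply hjinj
      rw [map_zero, ← inner_self_eq_zero (𝕜 := ℝ)]
      have h := (Submodule.mem_orthogonal _ _).1 hw (G (j w)) ⟨j w, rfl⟩
      rwa [hG, ContinuousLinearMap.adjoint_inner_left] at h
    exact Submodule.dense_iff_topologicalClosure_eq_top.2 this
  have hTtoD : ∀ x, ∃ w, j w = T x ∧ ‖w‖ = ‖x‖ := fun x => by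
    obtain ⟨w, hw, u, hu1, hu2⟩ := exists_tendsto_of_norm_eq T G hnormG
      (denseRange_of_isSelfAdjoint hTsa hTinj) x
    refine ⟨w, tendsto_nhds_unique (((j.continuous.tendsto w).comp hu2).congr fun n => ?_)
      ((T.continuous.tendsto x).comp hu1), hw⟩
    exact (hTTx (u n)).symm
  have hDtoT : ∀ w, ∃ x, T x = j w := fun w => by
    obtain ⟨x, -, u, hu1, hu2⟩ := exists_tendsto_of_norm_eq G T (fun y => (hnormG y).symm) hGdense w
    refine ⟨x, tendsto_nhds_unique (((T.continuous.tendsto x).comp hu2).congr fun n => ?_)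
      ((j.continuous.tendsto w).comp hu1)⟩
    exact hTTx (u n)
  have hnegL : ∀ f g : H, (f, g) ∈ (-graphOperator B (B - 1)).graph ↔
      ∃ x, B x = f ∧ x - B x = g := fun f g => by
    have : (f, g) ∈ (-graphOperator B (B - 1)).graph ↔
        (f, -g) ∈ (graphOperator B (B - 1)).graph := by
      simp only [LinearPMap.mem_graph_iff, LinearPMap.neg_apply, neg_eq_iff_eq_neg]
      rfl
    rw [this, mem_graph_graphOperator hBinj]
    refine exists_congr fun x => and_congr_right fun _ => ?_
    change B x - x = -g ↔ _
    rw [← neg_sub, neg_inj]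
  refine ⟨graphOperator B (B - 1), ?_, ?_, graphOperator T R, ⟨?_, ?_, ?_⟩, ?_, ?_⟩
  · exact isSelfAdjoint_graphOperator hBinj hBsa (hBsa.sub (IsSelfAdjoint.one _))
      ((Commute.refl B).sub_right (Commute.one_right B)) hsolveL
  · intro f
    obtain ⟨x, hx, hx'⟩ := exists_eq_graphOperator_apply hBinj f
    rw [← hx, ← hx']
    change inner ℝ (B x - x) (B x) ≤ 0
    rw [inner_sub_left, real_inner_self_eq_norm_sq]
    linarith [hBle x]
  · exact isSelfAdjoint_graphOperator hTinj hTsa hRsa hTR hsolveS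
  · intro f
    obtain ⟨x, hx, hx'⟩ := exists_eq_graphOperator_apply hTinj f
    -- `T R = Q R Q` with `Q² = T`, and `R = √(1 - B)` is again a square
    have hpos : ∀ y, 0 ≤ inner ℝ (R y) y := by
      obtain ⟨K, hKK, hKsa, -⟩ := exists_sqrt_of_norm_one_sub_le hRsa hR1
      intro y
      rw [← hKK]
      change 0 ≤ inner ℝ (K (K y)) y
      rw [sym hKsa]
      exact real_inner_self_nonneg
    rw [← hx, ← hx', ← hQQx, ← sym hQsa, ← hRQx]
    exact hpos _
  · intro f g
    rw [hnegL]
    simp only [mem_graph_graphOperator hTinj]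
    constructor
    · rintro ⟨x, rfl, rfl⟩
      exact ⟨T (R x), ⟨T x, hTTx x, (hTRx x).symm⟩, ⟨R x, rfl, hRRx x⟩⟩
    · rintro ⟨_, ⟨x, rfl, rfl⟩, ⟨y, hy, rfl⟩⟩
      obtain ⟨z, rfl, rfl⟩ := hsolveS x y hy
      exact ⟨z, (hTTx z).symm, (hRRx z).symm⟩
  · ext f
    rw [SetLike.mem_coe, mem_domain_graphOperator hTinj]
    constructor
    · rintro ⟨x, rfl⟩
      obtain ⟨w, hw, -⟩ := hTtoD x
      rw [← hw]
      exact hs.inclₗ_mem w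
    · intro hf
      obtain ⟨w, rfl⟩ := hs.exists_inclₗ_eq hf
      exact hDtoT w
  · intro f
    obtain ⟨x, hx, hx'⟩ := exists_eq_graphOperator_apply hTinj f
    obtain ⟨w, hw, hwx⟩ := hTtoD x
    have h1 := hs.norm_space_sq w
    rw [← hs.incl_apply, ← hj, hw, hwx] at h1
    rw [← hx, ← hx', ← real_inner_self_eq_norm_sq, sym hRsa, hRRx, inner_sub_right, ← hTTx,
      ← sym hTsa, real_inner_self_eq_norm_sq, real_inner_self_eq_norm_sq]
    linarith

end Generator

/-! ### Truncation -/

/-- The truncation of a real number to the interval `[-n, n]`. -/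
def truncReal (n : ℕ) (t : ℝ) : ℝ := max (-n) (min n t)

lemma continuous_truncReal (n : ℕ) : Continuous (truncReal n) := by
  unfold truncReal
  fun_prop

lemma abs_truncReal_le (n : ℕ) (t : ℝ) : |truncReal n t| ≤ n := by
  have : (0 : ℝ) ≤ n := n.cast_nonneg
  rw [truncReal, abs_le]
  exact ⟨le_max_left _ _, max_le (by linarith) (min_le_left _ _)⟩

lemma abs_truncReal_le_abs (n : ℕ) (t : ℝ) : |truncReal n t| ≤ |t| := by
  have : (0 : ℝ) ≤ n := n.cast_nonneg
  rw [truncReal, abs_le]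
  refine ⟨le_max_of_le_right (le_min ?_ (neg_abs_le t)), max_le ?_ ?_⟩
  · linarith [abs_nonneg t]
  · linarith [abs_nonneg t]
  · exact (min_le_right _ _).trans (le_abs_self t)

lemma truncReal_mono (n : ℕ) : Monotone (truncReal n) := fun _ _ h =>
  max_le_max le_rfl (min_le_min le_rfl h)

lemma abs_truncReal_sub_le (n : ℕ) (s t : ℝ) : |truncReal n s - truncReal n t| ≤ |s - t| :=
  (abs_max_sub_max_le_max _ _ _ _).trans <| by
    rw [sub_self, abs_zero]
    refine max_le (abs_nonneg _) ((abs_min_sub_min_le_max _ _ _ _).trans ?_)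
    rw [sub_self, abs_zero]
    exact max_le (abs_nonneg _) le_rfl

lemma sq_truncReal_sub_le (n : ℕ) (s t : ℝ) :
    (truncReal n s - truncReal n t) ^ 2 ≤ (s - t) * (truncReal n s - truncReal n t) := by
  have h := abs_truncReal_sub_le n s t
  rcases le_total s t with hst | hst
  · have h1 := truncReal_mono n hst
    rw [abs_of_nonpos (by linarith), abs_of_nonpos (by linarith)] at h
    nlinarith
  · have h1 := truncReal_mono n hst
    rw [abs_of_nonneg (by linarith), abs_of_nonneg (by linarith)] at h
    nlinarith

lemma tendsto_truncReal (t : ℝ) : Tendsto (fun n => truncReal n t) atTop (nhds t) := by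
  refine tendsto_const_nhds.congr' ?_
  obtain ⟨m, hm⟩ := exists_nat_ge |t|
  filter_upwards [eventually_ge_atTop m] with n hn
  have h1 : |t| ≤ n := hm.trans (by exact_mod_cast hn)
  rw [truncReal, min_eq_right ((le_abs_self t).trans h1), max_eq_right]
  linarith [neg_abs_le t]

section TruncLp

variable {Ω : Type*} [MeasurableSpace Ω] {P : Measure Ω}

lemma memLp_truncReal (n : ℕ) (f : Lp ℝ 2 P) : MemLp (fun ξ => truncReal n (f ξ)) 2 P :=
  (Lp.memLp f).of_le ((continuous_truncReal n).comp_aestronglyMeasurable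
    (Lp.aestronglyMeasurable f)) (Eventually.of_forall fun ξ => abs_truncReal_le_abs n (f ξ))

/-- The truncation of an element of `L²` to the interval `[-n, n]`. -/
noncomputable def truncLp (n : ℕ) (f : Lp ℝ 2 P) : Lp ℝ 2 P := (memLp_truncReal n f).toLp _

lemma coeFn_truncLp (n : ℕ) (f : Lp ℝ 2 P) : truncLp n f =ᵐ[P] fun ξ => truncReal n (f ξ) :=
  MemLp.coeFn_toLp _

lemma norm_truncLp_le (n : ℕ) (f : Lp ℝ 2 P) : ‖truncLp n f‖ ≤ ‖f‖ :=
  Lp.norm_le_norm_of_ae_le (by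
    filter_upwards [coeFn_truncLp n f] with ξ h
    rw [h]
    exact abs_truncReal_le_abs n _)

lemma mem_boundedMeasurable_of_ae {f : Lp ℝ 2 P} {C : ℝ} (h : ∀ᵐ ξ ∂P, |f ξ| ≤ C) :
    f ∈ boundedMeasurable P := by
  obtain ⟨n, hn⟩ := exists_nat_ge C
  refine ⟨fun ξ => truncReal n ((Lp.aestronglyMeasurable f).mk f ξ),
    (continuous_truncReal n).measurable.comp
      (Lp.aestronglyMeasurable f).stronglyMeasurable_mk.measurable,
    ⟨n, fun ξ => abs_truncReal_le n _⟩, ?_⟩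
  filter_upwards [h, (Lp.aestronglyMeasurable f).ae_eq_mk] with ξ h1 h2
  have h3 := abs_le.1 (h1.trans hn)
  rw [← h2, truncReal, min_eq_right h3.2, max_eq_right h3.1]

lemma truncLp_mem_boundedMeasurable (n : ℕ) (f : Lp ℝ 2 P) :
    truncLp n f ∈ boundedMeasurable P :=
  mem_boundedMeasurable_of_ae (C := n) (by
    filter_upwards [coeFn_truncLp n f] with ξ h
    rw [h]
    exact abs_truncReal_le n _)

lemma inner_Lp_eq (f g : Lp ℝ 2 P) : inner ℝ f g = ∫ ξ, f ξ * g ξ ∂P := by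
  rw [L2.inner_def]
  refine integral_congr_ae (Eventually.of_forall fun ξ => ?_)
  simp [mul_comm]

lemma tendsto_truncLp (f : Lp ℝ 2 P) :
    Tendsto (fun n => ‖f - truncLp n f‖ ^ 2) atTop (nhds 0) := by
  have h1 : ∀ n, ‖f - truncLp n f‖ ^ 2 = ∫ ξ, (f ξ - truncReal n (f ξ)) ^ 2 ∂P := fun n => by
    rw [← real_inner_self_eq_norm_sq, inner_Lp_eq]
    refine integral_congr_ae ?_
    filter_upwards [Lp.coeFn_sub f (truncLp n f), coeFn_truncLp n f] with ξ h1 h2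
    rw [h1, Pi.sub_apply, h2, sq]
  simp_rw [h1]
  rw [← integral_zero Ω ℝ (μ := P)]
  refine tendsto_integral_of_dominated_convergence (fun ξ => 4 * f ξ ^ 2) (fun n => ?_)
    ((Lp.memLp f).integrable_sq.const_mul 4) (fun n => ?_) ?_
  · exact ((Lp.aestronglyMeasurable f).sub (memLp_truncReal n f).1).pow 2
  · refine Eventually.of_forall fun ξ => ?_
    have h2 := abs_truncReal_le_abs n (f ξ)
    have h3 := abs_sub (f ξ) (truncReal n (f ξ))
    rw [Real.norm_eq_abs, abs_of_nonneg (sq_nonneg _), ← sq_abs (f ξ),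
      ← sq_abs (f ξ - truncReal n (f ξ))]
    nlinarith [abs_nonneg (f ξ - truncReal n (f ξ))]
  · refine Eventually.of_forall fun ξ => ?_
    have := ((tendsto_const_nhds (x := f ξ)).sub (tendsto_truncReal (f ξ))).pow 2
    simpa using this

end TruncLp

/-! ### The energy form of the random conductance model -/

section Model

variable {d : ℕ} {Ω : Type*} [MeasurableSpace Ω] [AddAction (Fin d → ℤ) Ω]
  {P : Measure Ω} {N : Finset (Fin d → ℤ)} {c : (Fin d → ℤ) → (Fin d → ℤ) → Ω → ℝ}

lemma energyForm_self (f : Lp ℝ 2 P) :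
    energyForm P N c f f = (1 / 2) * ∑ z ∈ N, ∫ ξ, c 0 z ξ * (f (z +ᵥ ξ) - f ξ) ^ 2 ∂P := by
  simp only [energyForm, mul_assoc, sq]

lemma energyForm_self_nonneg (hc : IsConductanceField N c) (f : Lp ℝ 2 P) :
    0 ≤ energyForm P N c f f := by
  rw [energyForm_self]
  exact mul_nonneg (by norm_num) (Finset.sum_nonneg fun z _ => integral_nonneg fun ξ =>
    mul_nonneg (hc.nonneg 0 z ξ) (sq_nonneg _))

variable [MeasurableConstVAdd (Fin d → ℤ) Ω] [VAddInvariantMeasure (Fin d → ℤ) Ω P]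

lemma ae_vadd {p : Ω → Prop} (h : ∀ᵐ ξ ∂P, p ξ) (z : Fin d → ℤ) : ∀ᵐ ξ ∂P, p (z +ᵥ ξ) :=
  (measurePreserving_vadd z P).quasiMeasurePreserving.ae h

lemma aestronglyMeasurable_gradient {f : Ω → ℝ} (hf : AEStronglyMeasurable f P) (z : Fin d → ℤ) :
    AEStronglyMeasurable (fun ξ => f (z +ᵥ ξ) - f ξ) P :=
  (hf.comp_quasiMeasurePreserving (measurePreserving_vadd z P).quasiMeasurePreserving).sub hf

lemma ae_gradient_add (f g : Lp ℝ 2 P) (z : Fin d → ℤ) :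
    ∀ᵐ ξ ∂P, (f + g) (z +ᵥ ξ) - (f + g) ξ = (f (z +ᵥ ξ) - f ξ) + (g (z +ᵥ ξ) - g ξ) := by
  filter_upwards [Lp.coeFn_add f g, ae_vadd (Lp.coeFn_add f g) z] with ξ h1 h2
  rw [h1, h2, Pi.add_apply, Pi.add_apply]
  ring

lemma ae_gradient_smul (a : ℝ) (f : Lp ℝ 2 P) (z : Fin d → ℤ) :
    ∀ᵐ ξ ∂P, (a • f) (z +ᵥ ξ) - (a • f) ξ = a * (f (z +ᵥ ξ) - f ξ) := by
  filter_upwards [Lp.coeFn_smul a f, ae_vadd (Lp.coeFn_smul a f) z] with ξ h1 h2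
  rw [h1, h2, Pi.smul_apply, Pi.smul_apply, smul_eq_mul, smul_eq_mul]
  ring

lemma aestronglyMeasurable_energyDensity (hc : IsConductanceField N c) {f g : Ω → ℝ}
    (hf : AEStronglyMeasurable f P) (hg : AEStronglyMeasurable g P) (z : Fin d → ℤ) :
    AEStronglyMeasurable (fun ξ => c 0 z ξ * (f (z +ᵥ ξ) - f ξ) * (g (z +ᵥ ξ) - g ξ)) P :=
  ((hc.measurable 0 z).aestronglyMeasurable.mul (aestronglyMeasurable_gradient hf z)).mul
    (aestronglyMeasurable_gradient hg z)

lemma aestronglyMeasurable_energyDensity_self (hc : IsConductanceField N c) {f : Ω → ℝ}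
    (hf : AEStronglyMeasurable f P) (z : Fin d → ℤ) :
    AEStronglyMeasurable (fun ξ => c 0 z ξ * (f (z +ᵥ ξ) - f ξ) ^ 2) P :=
  (hc.measurable 0 z).aestronglyMeasurable.mul ((aestronglyMeasurable_gradient hf z).pow 2)

lemma mem_energyDomain_iff (hc : IsConductanceField N c) (f : Lp ℝ 2 P) :
    f ∈ energyDomain P N c ↔
      ∀ z ∈ N, Integrable (fun ξ => c 0 z ξ * (f (z +ᵥ ξ) - f ξ) ^ 2) P := by
  rw [energyDomain, Set.mem_ofPred_eq, ENNReal.sum_lt_top]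
  refine forall₂_congr fun z _ => ?_
  rw [Integrable, hasFiniteIntegral_iff_ofReal (Eventually.of_forall fun ξ =>
    mul_nonneg (hc.nonneg 0 z ξ) (sq_nonneg _))]
  exact (and_iff_right
    (aestronglyMeasurable_energyDensity_self hc (Lp.aestronglyMeasurable f) z)).symm

lemma integrable_energyDensity (hc : IsConductanceField N c) {f g : Lp ℝ 2 P}
    (hf : f ∈ energyDomain P N c) (hg : g ∈ energyDomain P N c) {z : Fin d → ℤ} (hz : z ∈ N) :
    Integrable (fun ξ => c 0 z ξ * (f (z +ᵥ ξ) - f ξ) * (g (z +ᵥ ξ) - g ξ)) P := by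
  refine (((mem_energyDomain_iff hc f).1 hf z hz).add ((mem_energyDomain_iff hc g).1 hg z hz)).mono'
    (aestronglyMeasurable_energyDensity hc (Lp.aestronglyMeasurable f)
      (Lp.aestronglyMeasurable g) z) (Eventually.of_forall fun ξ => ?_)
  have h0 := hc.nonneg 0 z ξ
  simp only [Pi.add_apply]
  rw [Real.norm_eq_abs, mul_assoc, abs_mul, abs_of_nonneg h0, ← mul_add]
  refine mul_le_mul_of_nonneg_left ?_ h0
  rw [abs_le]
  constructor <;> nlinarith [sq_nonneg (f (z +ᵥ ξ) - f ξ + (g (z +ᵥ ξ) - g ξ)),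
    sq_nonneg (f (z +ᵥ ξ) - f ξ - (g (z +ᵥ ξ) - g ξ)), sq_nonneg (f (z +ᵥ ξ) - f ξ),
    sq_nonneg (g (z +ᵥ ξ) - g ξ)]

lemma energyForm_self_eq_toReal (hc : IsConductanceField N c) {f : Lp ℝ 2 P}
    (hf : f ∈ energyDomain P N c) :
    energyForm P N c f f = (1 / 2) *
      (∑ z ∈ N, ∫⁻ ξ, ENNReal.ofReal (c 0 z ξ * (f (z +ᵥ ξ) - f ξ) ^ 2) ∂P).toReal := by
  rw [energyForm_self, ENNReal.toReal_sum fun z hz => (ENNReal.sum_lt_top.1 hf z hz).ne]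
  congr 1
  refine Finset.sum_congr rfl fun z _ => ?_
  exact integral_eq_lintegral_of_nonneg_ae
    (Eventually.of_forall fun ξ => mul_nonneg (hc.nonneg 0 z ξ) (sq_nonneg _))
    (aestronglyMeasurable_energyDensity_self hc (Lp.aestronglyMeasurable f) z)

/-- Comparison principle behind the Markovian property: a smaller gradient has a smaller energy. -/
lemma energy_le_of_gradient_le (hc : IsConductanceField N c) {f g : Lp ℝ 2 P}
    (hg : g ∈ energyDomain P N c)
    (h : ∀ z ∈ N, ∀ᵐ ξ ∂P, |f (z +ᵥ ξ) - f ξ| ≤ |g (z +ᵥ ξ) - g ξ|) :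
    f ∈ energyDomain P N c ∧ energyForm P N c f f ≤ energyForm P N c g g := by
  have hle : ∑ z ∈ N, ∫⁻ ξ, ENNReal.ofReal (c 0 z ξ * (f (z +ᵥ ξ) - f ξ) ^ 2) ∂P ≤
      ∑ z ∈ N, ∫⁻ ξ, ENNReal.ofReal (c 0 z ξ * (g (z +ᵥ ξ) - g ξ) ^ 2) ∂P :=
    Finset.sum_le_sum fun z hz => lintegral_mono_ae (by
      filter_upwards [h z hz] with ξ hξ
      exact ENNReal.ofReal_le_ofReal
        (mul_le_mul_of_nonneg_left (sq_le_sq.2 hξ) (hc.nonneg 0 z ξ)))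
  have hf : f ∈ energyDomain P N c := hle.trans_lt hg
  refine ⟨hf, ?_⟩
  rw [energyForm_self_eq_toReal hc hf, energyForm_self_eq_toReal hc hg]
  exact mul_le_mul_of_nonneg_left (ENNReal.toReal_mono hg.ne hle) (by norm_num)

/-- Lower semicontinuity of the energy along almost everywhere convergent sequences. -/
lemma energy_le_of_tendsto (hc : IsConductanceField N c) {v : ℕ → Lp ℝ 2 P} {f : Lp ℝ 2 P} {K : ℝ}
    (hv : ∀ k, v k ∈ energyDomain P N c) (hK : ∀ k, energyForm P N c (v k) (v k) ≤ K)
    (hlim : ∀ᵐ ξ ∂P, Tendsto (fun k => v k ξ) atTop (nhds (f ξ))) :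
    f ∈ energyDomain P N c ∧ energyForm P N c f f ≤ K := by
  have hK0 : 0 ≤ K := (energyForm_self_nonneg hc _).trans (hK 0)
  have meas : ∀ (g : Lp ℝ 2 P), ∀ z ∈ N,
      AEMeasurable (fun ξ => ENNReal.ofReal (c 0 z ξ * (g (z +ᵥ ξ) - g ξ) ^ 2)) P :=
    fun g z _ => (aestronglyMeasurable_energyDensity_self hc
      (Lp.aestronglyMeasurable g) z).aemeasurable.ennreal_ofReal
  have hle : ∑ z ∈ N, ∫⁻ ξ, ENNReal.ofReal (c 0 z ξ * (f (z +ᵥ ξ) - f ξ) ^ 2) ∂P ≤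
      ENNReal.ofReal (2 * K) := by
    rw [← lintegral_finsetSum' N (meas f)]
    calc ∫⁻ ξ, ∑ z ∈ N, ENNReal.ofReal (c 0 z ξ * (f (z +ᵥ ξ) - f ξ) ^ 2) ∂P
        = ∫⁻ ξ, liminf (fun k => ∑ z ∈ N,
            ENNReal.ofReal (c 0 z ξ * (v k (z +ᵥ ξ) - v k ξ) ^ 2)) atTop ∂P := by
          refine lintegral_congr_ae ?_
          have hall : ∀ᵐ ξ ∂P, ∀ z ∈ N,
              Tendsto (fun k => v k (z +ᵥ ξ)) atTop (nhds (f (z +ᵥ ξ))) :=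
            (Finset.eventually_all N).2 fun z _ => ae_vadd hlim z
          filter_upwards [hlim, hall] with ξ h1 h2
          refine (Tendsto.liminf_eq (tendsto_finsetSum N fun z hz => ?_)).symm
          exact ENNReal.tendsto_ofReal ((((h2 z hz).sub h1).pow 2).const_mul _)
      _ ≤ liminf (fun k => ∫⁻ ξ, ∑ z ∈ N,
            ENNReal.ofReal (c 0 z ξ * (v k (z +ᵥ ξ) - v k ξ) ^ 2) ∂P) atTop :=
          lintegral_liminf_le' fun k => Finset.aemeasurable_fun_sum N (meas (v k))
      _ ≤ ENNReal.ofReal (2 * K) := by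
          refine (liminf_le_liminf (Eventually.of_forall fun k => ?_)).trans
            (liminf_const (f := (atTop : Filter ℕ)) _).le
          rw [lintegral_finsetSum' N (meas (v k)), ← ENNReal.ofReal_toReal (hv k).ne]
          refine ENNReal.ofReal_le_ofReal ?_
          have := hK k
          rw [energyForm_self_eq_toReal hc (hv k)] at this
          linarith
  have hf : f ∈ energyDomain P N c := hle.trans_lt ENNReal.ofReal_lt_top
  refine ⟨hf, ?_⟩
  rw [energyForm_self_eq_toReal hc hf]
  have := ENNReal.toReal_mono ENNReal.ofReal_ne_top hle
  rw [ENNReal.toReal_ofReal (by linarith)] at this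
  linarith

lemma boundedMeasurable_subset_energyDomain (hc : IsConductanceField N c)
    (hint : ∀ z ∈ N, Integrable (c 0 z) P) : boundedMeasurable P ⊆ energyDomain P N c := by
  rintro f ⟨g, -, ⟨C, hC⟩, hfg⟩
  rw [mem_energyDomain_iff hc]
  intro z hz
  refine ((hint z hz).const_mul (4 * C ^ 2)).mono'
    (aestronglyMeasurable_energyDensity_self hc (Lp.aestronglyMeasurable f) z) ?_
  filter_upwards [hfg, ae_vadd hfg z] with ξ h1 h2
  rw [h1, h2, Real.norm_eq_abs, abs_of_nonneg (mul_nonneg (hc.nonneg 0 z ξ) (sq_nonneg _)),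
    mul_comm (c 0 z ξ)]
  refine mul_le_mul_of_nonneg_right ?_ (hc.nonneg 0 z ξ)
  have h3 := abs_le.1 (hC ξ)
  have h4 := abs_le.1 (hC (z +ᵥ ξ))
  nlinarith

theorem isSymmetricForm_energyForm (hc : IsConductanceField N c)
    (hint : ∀ z ∈ N, Integrable (c 0 z) P) :
    IsSymmetricForm (energyDomain P N c) (energyForm P N c) where
  zero_mem := by
    refine (mem_energyDomain_iff hc 0).2 fun z _ => (integrable_zero Ω ℝ P).congr ?_
    have h : ∀ᵐ ξ ∂P, (0 : Lp ℝ 2 P) ξ = 0 := Lp.coeFn_zero ℝ 2 P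
    filter_upwards [h, ae_vadd h z] with ξ h1 h2
    rw [h1, h2]
    simp
  add_mem f hf g hg := by
    refine (mem_energyDomain_iff hc _).2 fun z hz => ?_
    refine ((((mem_energyDomain_iff hc f).1 hf z hz).add
      ((integrable_energyDensity hc hf hg hz).const_mul 2)).add
      ((mem_energyDomain_iff hc g).1 hg z hz)).congr ?_
    filter_upwards [ae_gradient_add f g z] with ξ h
    rw [h]
    simp only [Pi.add_apply]
    ring
  smul_mem a f hf := by
    refine (mem_energyDomain_iff hc _).2 fun z hz => ?_
    refine (((mem_energyDomain_iff hc f).1 hf z hz).const_mul (a ^ 2)).congr ?_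
    filter_upwards [ae_gradient_smul a f z] with ξ h
    rw [h]
    ring
  dense := fun f => by
    refine mem_closure_of_tendsto (f := fun n => truncLp n f) (b := atTop) ?_
      (Eventually.of_forall fun n => boundedMeasurable_subset_energyDomain hc hint
        (truncLp_mem_boundedMeasurable n f))
    rw [tendsto_iff_norm_sub_tendsto_zero]
    have := (tendsto_truncLp f).sqrt
    simpa [Real.sqrt_sq, norm_sub_rev] using this
  add_left f hf g hg k hk := by
    simp only [energyForm]
    rw [← mul_add, ← Finset.sum_add_distrib]
    congr 1
    refine Finset.sum_congr rfl fun z hz => ?_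
    rw [← integral_add (integrable_energyDensity hc hf hk hz)
      (integrable_energyDensity hc hg hk hz)]
    refine integral_congr_ae ?_
    filter_upwards [ae_gradient_add f g z] with ξ h
    rw [h]
    ring
  smul_left a f hf k hk := by
    simp only [energyForm]
    rw [mul_left_comm a, Finset.mul_sum N _ a]
    congr 1
    refine Finset.sum_congr rfl fun z hz => ?_
    rw [← integral_const_mul]
    refine integral_congr_ae ?_
    filter_upwards [ae_gradient_smul a f z] with ξ h
    rw [h]
    ring
  symm f _ g _ := by
    simp only [energyForm]
    congr 1
    refine Finset.sum_congr rfl fun z _ => integral_congr_ae (Eventually.of_forall fun ξ => ?_)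
    ring
  nonneg f _ := energyForm_self_nonneg hc f

theorem isClosedForm_energyForm (hc : IsConductanceField N c)
    (hint : ∀ z ∈ N, Integrable (c 0 z) P) :
    IsClosedForm (energyDomain P N c) (energyForm P N c) := by
  have hs := isSymmetricForm_energyForm (P := P) hc hint
  have hsq : ∀ g : Lp ℝ 2 P, 0 ≤ ‖g‖ ^ 2 + energyForm P N c g g := fun g =>
    add_nonneg (sq_nonneg _) (energyForm_self_nonneg hc g)
  intro u hu hcau
  have hsmall : ∀ ε > 0, ∃ n₀, ∀ m ≥ n₀, ∀ n ≥ n₀,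
      ‖u m - u n‖ ^ 2 + energyForm P N c (u m - u n) (u m - u n) < ε ^ 2 := fun ε hε => by
    obtain ⟨n₀, hn⟩ := hcau ε hε
    exact ⟨n₀, fun m hm n hn' => (Real.sqrt_lt' hε).1 (hn m hm n hn')⟩
  have hcauL : CauchySeq u := by
    refine Metric.cauchySeq_iff.2 fun ε hε => ?_
    obtain ⟨n₀, hn⟩ := hsmall ε hε
    refine ⟨n₀, fun m hm n hn' => ?_⟩
    rw [dist_eq_norm]
    refine lt_of_pow_lt_pow_left₀ 2 hε.le ?_
    have := hn m hm n hn'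
    linarith [energyForm_self_nonneg (P := P) hc (u m - u n)]
  obtain ⟨f, hf⟩ := cauchySeq_tendsto_of_complete hcauL
  obtain ⟨φ, hφ, hφlim⟩ := (tendstoInMeasure_of_tendsto_Lp hf).exists_seq_tendsto_ae
  have key : ∀ ε > 0, ∃ n₀, ∀ m ≥ n₀, u m - f ∈ energyDomain P N c ∧
      energyForm P N c (u m - f) (u m - f) ≤ ε ^ 2 := fun ε hε => by
    obtain ⟨n₀, hn⟩ := hsmall ε hε
    refine ⟨n₀, fun m hm => energy_le_of_tendsto hc (v := fun k => u m - u (φ (k + n₀)))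
      (fun k => hs.sub_mem (hu _) (hu _)) (fun k => ?_) ?_⟩
    · have := hn m hm (φ (k + n₀)) ((Nat.le_add_left n₀ k).trans (hφ.id_le (k + n₀)))
      linarith [sq_nonneg ‖u m - u (φ (k + n₀))‖]
    · have hall : ∀ᵐ ξ ∂P, ∀ k, (u m - u (φ (k + n₀))) ξ = u m ξ - u (φ (k + n₀)) ξ :=
        ae_all_iff.2 fun k => Lp.coeFn_sub _ _
      filter_upwards [hφlim, hall, Lp.coeFn_sub (u m) f] with ξ h1 h2 h3
      simp_rw [h2, h3]
      exact tendsto_const_nhds.sub (h1.comp (tendsto_add_atTop_nat n₀))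
  refine ⟨f, ?_, ?_⟩
  · obtain ⟨n₀, hn⟩ := key 1 one_pos
    have := hs.sub_mem (hu n₀) (hn n₀ le_rfl).1
    rwa [sub_sub_cancel] at this
  · have hE : Tendsto (fun n => energyForm P N c (u n - f) (u n - f)) atTop (nhds 0) := by
      refine Metric.tendsto_atTop.2 fun ε hε => ?_
      obtain ⟨n₀, hn⟩ := key (Real.sqrt (ε / 2)) (Real.sqrt_pos.2 (by linarith))
      refine ⟨n₀, fun m hm => ?_⟩
      rw [Real.dist_eq, sub_zero, abs_of_nonneg (energyForm_self_nonneg hc _)]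
      have := (hn m hm).2
      rw [Real.sq_sqrt (by linarith)] at this
      linarith
    have := (((tendsto_iff_norm_sub_tendsto_zero.1 hf).pow 2).add hE).sqrt
    simpa [formNorm] using this

theorem isMarkovianForm_energyForm (hc : IsConductanceField N c) :
    IsMarkovianForm (energyDomain P N c) (energyForm P N c) := by
  intro u hu u' v' huu' ⟨hv, hv0⟩
  -- `v'` is a `1`-Lipschitz function of `u'`, hence measurable up to null sets
  have hfact : ∃ ψ : ℝ → ℝ, Continuous ψ ∧ v' = fun ξ => ψ (u' ξ) := by
    have hψ : ∃ ψ : ℝ → ℝ, LipschitzOnWith 1 ψ (Set.range u') ∧ v' = fun ξ => ψ (u' ξ) := by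
      have hex : ∀ t : Set.range u', ∃ ξ, u' ξ = t := fun t => t.2
      classical
      choose r hr using hex
      have hvr : ∀ ξ, v' ξ = v' (r ⟨u' ξ, ξ, rfl⟩) := fun ξ => by
        have := hv ξ (r ⟨u' ξ, ξ, rfl⟩)
        rw [hr, sub_self, abs_zero] at this
        exact sub_eq_zero.1 (abs_nonpos_iff.1 this)
      refine ⟨fun t => if h : t ∈ Set.range u' then v' (r ⟨t, h⟩) else 0, ?_, ?_⟩
      · refine LipschitzOnWith.of_dist_le_mul ?_
        rintro _ ⟨ξ, rfl⟩ _ ⟨ξ', rfl⟩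
        simp only [Set.mem_range_self, dite_true]
        rw [← hvr, ← hvr, NNReal.coe_one, one_mul, Real.dist_eq, Real.dist_eq]
        exact hv ξ ξ'
      · funext ξ
        simp only [Set.mem_range_self, dite_true]
        exact hvr ξ
    obtain ⟨ψ, hψ, hv'⟩ := hψ
    obtain ⟨g, hg, hgψ⟩ := hψ.extend_real
    refine ⟨g, hg.continuous, ?_⟩
    rw [hv']
    funext ξ
    exact hgψ ⟨ξ, rfl⟩
  obtain ⟨ψ, hψ, hv'⟩ := hfact
  have hu'm : MemLp u' 2 P := (memLp_congr_ae huu').2 (Lp.memLp u)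
  have hv'm : MemLp v' 2 P := by
    refine hu'm.of_le ?_ (Eventually.of_forall hv0)
    rw [hv']
    exact hψ.comp_aestronglyMeasurable hu'm.1
  have hvv' := hv'm.coeFn_toLp
  obtain ⟨h1, h2⟩ := energy_le_of_gradient_le hc (f := hv'm.toLp v') hu fun z _ => by
    filter_upwards [hvv', ae_vadd hvv' z, huu', ae_vadd huu' z] with ξ h1 h2 h3 h4
    rw [h1, h2, ← h3, ← h4]
    exact hv _ _
  exact ⟨_, h1, hvv', h2⟩

theorem isFormCore_boundedMeasurable (hc : IsConductanceField N c)
    (hint : ∀ z ∈ N, Integrable (c 0 z) P) :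
    IsFormCore (boundedMeasurable P) (energyDomain P N c) (energyForm P N c) := by
  refine ⟨boundedMeasurable_subset_energyDomain hc hint, fun f hf ε hε => ?_⟩
  have hE : Tendsto (fun n => energyForm P N c (f - truncLp n f) (f - truncLp n f)) atTop
      (nhds 0) := by
    have hz : ∀ z ∈ N, Tendsto (fun n => ∫ ξ, c 0 z ξ *
        ((f - truncLp n f) (z +ᵥ ξ) - (f - truncLp n f) ξ) ^ 2 ∂P) atTop (nhds 0) := by
      intro z hz
      have hae : ∀ n, ∀ᵐ ξ ∂P, (f - truncLp n f) (z +ᵥ ξ) - (f - truncLp n f) ξ =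
          (f (z +ᵥ ξ) - f ξ) - (truncReal n (f (z +ᵥ ξ)) - truncReal n (f ξ)) := fun n => by
        have h : ∀ᵐ ξ ∂P, (f - truncLp n f) ξ = f ξ - truncReal n (f ξ) := by
          filter_upwards [Lp.coeFn_sub f (truncLp n f), coeFn_truncLp n f] with ξ h1 h2
          rw [h1, Pi.sub_apply, h2]
        filter_upwards [h, ae_vadd h z] with ξ h1 h2
        rw [h1, h2]
        ring
      rw [← integral_zero Ω ℝ (μ := P)]
      refine tendsto_integral_of_dominated_convergence
        (fun ξ => 4 * (c 0 z ξ * (f (z +ᵥ ξ) - f ξ) ^ 2)) (fun n => ?_)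
        (((mem_energyDomain_iff hc f).1 hf z hz).const_mul 4) (fun n => ?_) ?_
      · exact aestronglyMeasurable_energyDensity_self hc (Lp.aestronglyMeasurable _) z
      · filter_upwards [hae n] with ξ h
        have h0 := hc.nonneg 0 z ξ
        rw [h, Real.norm_eq_abs, abs_of_nonneg (mul_nonneg h0 (sq_nonneg _)), mul_left_comm]
        refine mul_le_mul_of_nonneg_left ?_ h0
        have h2 := abs_truncReal_sub_le n (f (z +ᵥ ξ)) (f ξ)
        have h3 := abs_sub (f (z +ᵥ ξ) - f ξ) (truncReal n (f (z +ᵥ ξ)) - truncReal n (f ξ))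
        rw [← sq_abs (f (z +ᵥ ξ) - f ξ), ← sq_abs (_ - (truncReal n _ - _))]
        nlinarith [abs_nonneg (f (z +ᵥ ξ) - f ξ -
          (truncReal n (f (z +ᵥ ξ)) - truncReal n (f ξ)))]
      · filter_upwards [ae_all_iff.2 hae] with ξ h
        simp_rw [h]
        have := (((tendsto_const_nhds (x := f (z +ᵥ ξ) - f ξ)).sub
          ((tendsto_truncReal (f (z +ᵥ ξ))).sub (tendsto_truncReal (f ξ)))).pow 2).const_mul
          (c 0 z ξ)
        simpa using this
    simp_rw [energyForm_self]
    have := (tendsto_finsetSum N hz).const_mul (1 / 2)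
    rwa [Finset.sum_const_zero, mul_zero] at this
  have hlim := ((tendsto_truncLp f).add hE).sqrt
  rw [add_zero, Real.sqrt_zero] at hlim
  obtain ⟨n, hn⟩ := (hlim.eventually (gt_mem_nhds hε)).exists
  exact ⟨truncLp n f, truncLp_mem_boundedMeasurable n f, hn⟩

end Model

/-! ### The pointwise generator -/

section PointGenerator

variable {d : ℕ} {Ω : Type*} [MeasurableSpace Ω] [AddAction (Fin d → ℤ) Ω]
  [MeasurableConstVAdd (Fin d → ℤ) Ω] {P : Measure Ω} [VAddInvariantMeasure (Fin d → ℤ) Ω P]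
  {N : Finset (Fin d → ℤ)} {c : (Fin d → ℤ) → (Fin d → ℤ) → Ω → ℝ}

/-- Stationarity and the symmetry of the conductances: shifting by `-z` turns the current of `f`
through the edge `(0, z)` into minus the one through `(0, -z)`. -/
lemma integral_current_mul_shift (hc : IsConductanceField N c)
    (hcov : ∀ (x y z : Fin d → ℤ) (ξ : Ω), c (x + z) (y + z) ξ = c x y (z +ᵥ ξ))
    (f k : Ω → ℝ) (z : Fin d → ℤ) :
    ∫ ξ, c 0 z ξ * (f (z +ᵥ ξ) - f ξ) * k (z +ᵥ ξ) ∂P =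
      -∫ ξ, c 0 (-z) ξ * (f (-z +ᵥ ξ) - f ξ) * k ξ ∂P := by
  rw [← integral_vadd_eq_self (g := -z) (fun ξ => c 0 z ξ * (f (z +ᵥ ξ) - f ξ) * k (z +ᵥ ξ)),
    ← integral_neg]
  refine integral_congr_ae (Eventually.of_forall fun ξ => ?_)
  have h : c 0 z (-z +ᵥ ξ) = c 0 (-z) ξ := by
    rw [← hcov, zero_add, add_neg_cancel, hc.symm]
  simp only [vadd_vadd, add_neg_cancel, zero_vadd, h]
  ring

/-- Summation by parts, `½ ∑ E[c_{0,z} ∇_z f ∇_z k] = -E[(L f) k]`, for bounded `k`. -/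
lemma energyForm_eq_neg_integral_pointGenerator (hN : ∀ z ∈ N, -z ∈ N)
    (hc : IsConductanceField N c)
    (hcov : ∀ (x y z : Fin d → ℤ) (ξ : Ω), c (x + z) (y + z) ξ = c x y (z +ᵥ ξ))
    {f k : Lp ℝ 2 P} (hf : ∀ z ∈ N, Integrable (fun ξ => c 0 z ξ * (f (z +ᵥ ξ) - f ξ)) P)
    (hk : k ∈ boundedMeasurable P) :
    (∀ z ∈ N, Integrable (fun ξ => c 0 z ξ * (f (z +ᵥ ξ) - f ξ) * (k (z +ᵥ ξ) - k ξ)) P) ∧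
    energyForm P N c f k = -∫ ξ, pointGenerator N c f ξ * k ξ ∂P := by
  obtain ⟨k', -, ⟨C, hC⟩, hkk'⟩ := hk
  have hb : ∀ᵐ ξ ∂P, ‖k ξ‖ ≤ C := by
    filter_upwards [hkk'] with ξ h
    rw [h]
    exact hC ξ
  have h1 : ∀ z ∈ N, Integrable (fun ξ => c 0 z ξ * (f (z +ᵥ ξ) - f ξ) * k ξ) P := fun z hz =>
    (hf z hz).mul_bdd (Lp.aestronglyMeasurable k) hb
  have h2 : ∀ z ∈ N, Integrable (fun ξ => c 0 z ξ * (f (z +ᵥ ξ) - f ξ) * k (z +ᵥ ξ)) P :=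
    fun z hz => (hf z hz).mul_bdd ((Lp.aestronglyMeasurable k).comp_quasiMeasurePreserving
      (measurePreserving_vadd z P).quasiMeasurePreserving) (ae_vadd hb z)
  refine ⟨fun z hz => (((h2 z hz).sub (h1 z hz))).congr
    (Eventually.of_forall fun ξ => (mul_sub _ _ _).symm), ?_⟩
  have hshift : ∑ z ∈ N, ∫ ξ, c 0 z ξ * (f (z +ᵥ ξ) - f ξ) * k (z +ᵥ ξ) ∂P =
      -∑ z ∈ N, ∫ ξ, c 0 z ξ * (f (z +ᵥ ξ) - f ξ) * k ξ ∂P := by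
    rw [← Finset.sum_neg_distrib]
    refine Finset.sum_nbij' (fun z => -z) (fun z => -z) (fun z hz => hN z hz)
      (fun z hz => hN z hz) (fun z _ => neg_neg z) (fun z _ => neg_neg z) fun z _ => ?_
    exact integral_current_mul_shift hc hcov f k z
  have hgen : ∫ ξ, pointGenerator N c f ξ * k ξ ∂P =
      ∑ z ∈ N, ∫ ξ, c 0 z ξ * (f (z +ᵥ ξ) - f ξ) * k ξ ∂P := by
    rw [← integral_finsetSum N h1]
    simp only [pointGenerator, Finset.sum_mul]
  rw [hgen, energyForm]
  simp_rw [mul_sub (c 0 _ _ * _)]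
  rw [Finset.sum_congr rfl fun z hz => integral_sub (h2 z hz) (h1 z hz), Finset.sum_sub_distrib,
    hshift]
  ring

/-- If the pointwise generator of `f` is square integrable then `f` has finite energy: testing
with the truncations `f_n` of `f` gives `E(f_n, f_n) ≤ E(f, f_n) = -⟪L f, f_n⟫ ≤ ‖L f‖ ‖f‖`. -/
lemma mem_energyDomain_of_memLp_pointGenerator (hN : ∀ z ∈ N, -z ∈ N)
    (hc : IsConductanceField N c)
    (hcov : ∀ (x y z : Fin d → ℤ) (ξ : Ω), c (x + z) (y + z) ξ = c x y (z +ᵥ ξ))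
    (hint : ∀ z ∈ N, Integrable (c 0 z) P)
    {f : Lp ℝ 2 P} (hf : ∀ z ∈ N, Integrable (fun ξ => c 0 z ξ * (f (z +ᵥ ξ) - f ξ)) P)
    (hL : MemLp (pointGenerator N c f) 2 P) : f ∈ energyDomain P N c := by
  have hmem : ∀ n, truncLp n f ∈ energyDomain P N c := fun n =>
    boundedMeasurable_subset_energyDomain hc hint (truncLp_mem_boundedMeasurable n f)
  refine (energy_le_of_tendsto hc (v := fun n => truncLp n f) (K := ‖hL.toLp _‖ * ‖f‖) hmem
    (fun n => ?_) ?_).1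
  · obtain ⟨hi, he⟩ := energyForm_eq_neg_integral_pointGenerator hN hc hcov hf
      (truncLp_mem_boundedMeasurable n f)
    have h1 : energyForm P N c (truncLp n f) (truncLp n f) ≤ energyForm P N c f (truncLp n f) := by
      refine mul_le_mul_of_nonneg_left (Finset.sum_le_sum fun z hz => ?_) (by norm_num)
      refine integral_mono_ae (integrable_energyDensity hc (hmem n) (hmem n) hz) (hi z hz) ?_
      filter_upwards [coeFn_truncLp n f, ae_vadd (coeFn_truncLp n f) z] with ξ h1 h2
      rw [h1, h2, mul_assoc, mul_assoc, ← sq]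
      exact mul_le_mul_of_nonneg_left (sq_truncReal_sub_le n _ _) (hc.nonneg 0 z ξ)
    have h2 : ∫ ξ, pointGenerator N c f ξ * truncLp n f ξ ∂P =
        inner ℝ (hL.toLp _) (truncLp n f) := by
      rw [inner_Lp_eq]
      refine integral_congr_ae ?_
      filter_upwards [hL.coeFn_toLp] with ξ h
      rw [h]
    calc _ ≤ _ := h1
      _ = -inner ℝ (hL.toLp _) (truncLp n f) := by rw [he, h2]
      _ ≤ ‖hL.toLp _‖ * ‖truncLp n f‖ := (neg_le_abs _).trans (abs_real_inner_le_norm _ _)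
      _ ≤ _ := by gcongr; exact norm_truncLp_le n f
  · filter_upwards [ae_all_iff.2 fun n => coeFn_truncLp n f] with ξ h
    simp_rw [h]
    exact tendsto_truncReal _

/-- The generator of the energy form acts as the pointwise generator wherever the latter is square
integrable. -/
theorem IsFormGenerator.mem_graph_of_memLp_pointGenerator (hN : ∀ z ∈ N, -z ∈ N)
    (hc : IsConductanceField N c)
    (hcov : ∀ (x y z : Fin d → ℤ) (ξ : Ω), c (x + z) (y + z) ξ = c x y (z +ᵥ ξ))
    (hint : ∀ z ∈ N, Integrable (c 0 z) P) {L : Lp ℝ 2 P →ₗ.[ℝ] Lp ℝ 2 P}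
    (hgen : IsFormGenerator (energyDomain P N c) (energyForm P N c) L)
    {f : Lp ℝ 2 P} (hf : ∀ z ∈ N, Integrable (fun ξ => c 0 z ξ * (f (z +ᵥ ξ) - f ξ)) P)
    (hL : MemLp (pointGenerator N c f) 2 P) : (f, hL.toLp _) ∈ L.graph := by
  have hs := isSymmetricForm_energyForm (P := P) hc hint
  have hfD := mem_energyDomain_of_memLp_pointGenerator hN hc hcov hint hf hL
  refine (hgen.mem_graph_iff hs f _).2 ⟨hfD, ?_⟩
  refine (isFormCore_boundedMeasurable hc hint).eq_neg_inner hs hfD fun k hk => ?_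
  rw [(energyForm_eq_neg_integral_pointGenerator hN hc hcov hf hk).2, inner_Lp_eq, neg_inj]
  refine integral_congr_ae ?_
  filter_upwards [hL.coeFn_toLp] with ξ h
  rw [h]

end PointGenerator

theorem proposition2p2 {d : ℕ} {Ω : Type*} [MeasurableSpace Ω]
    [AddAction (Fin d → ℤ) Ω] [MeasurableConstVAdd (Fin d → ℤ) Ω]
    (P : Measure Ω) [IsProbabilityMeasure P]
    -- stationarity and ergodicity of `P` under the action of `ℤᵈ`
    [ErgodicVAdd (Fin d → ℤ) Ω P]
    (N : Finset (Fin d → ℤ)) (hN : IsGoodNeighbourhood N)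
    (c : (Fin d → ℤ) → (Fin d → ℤ) → Ω → ℝ) (hc : IsConductanceField N c)
    (hcov : ∀ (x y z : Fin d → ℤ) (ξ : Ω), c (x + z) (y + z) ξ = c x y (z +ᵥ ξ))
    (hint : ∀ z ∈ N, Integrable (c 0 z) P) :
    -- the expectations defining the form on its domain exist
    (∀ f ∈ energyDomain P N c, ∀ g ∈ energyDomain P N c, ∀ z ∈ N,
      Integrable (fun ξ => c 0 z ξ * (f (z +ᵥ ξ) - f ξ) * (g (z +ᵥ ξ) - g ξ)) P) ∧
    IsDirichletForm (energyDomain P N c) (energyForm P N c) ∧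
    IsFormCore (boundedMeasurable P) (energyDomain P N c) (energyForm P N c) ∧
    ∃ L : Lp ℝ 2 P →ₗ.[ℝ] Lp ℝ 2 P,
      IsFormGenerator (energyDomain P N c) (energyForm P N c) L ∧
      (∀ L' : Lp ℝ 2 P →ₗ.[ℝ] Lp ℝ 2 P,
        IsFormGenerator (energyDomain P N c) (energyForm P N c) L' → L' = L) ∧
      (∀ f : Lp ℝ 2 P,
        (∀ z ∈ N, Integrable (fun ξ => c 0 z ξ * (f (z +ᵥ ξ) - f ξ)) P) →
        MemLp (pointGenerator N c f) 2 P →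
        ∃ hf : f ∈ L.domain, L ⟨f, hf⟩ =ᵐ[P] pointGenerator N c f) ∧
      ((∀ z ∈ N, Integrable (fun ξ => c 0 z ξ ^ 2) P) →
        ∀ f : Ω → ℝ, Measurable f → (∃ C : ℝ, ∀ ξ, |f ξ| ≤ C) →
        ∃ F : L.domain, (F : Lp ℝ 2 P) =ᵐ[P] f ∧ L F =ᵐ[P] pointGenerator N c f) := by
  have hs := isSymmetricForm_energyForm (P := P) hc hint
  have hcl := isClosedForm_energyForm (P := P) hc hint
  obtain ⟨L, hL⟩ := exists_isFormGenerator hs hcl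
  have hpoint : ∀ f : Lp ℝ 2 P,
      (∀ z ∈ N, Integrable (fun ξ => c 0 z ξ * (f (z +ᵥ ξ) - f ξ)) P) →
      MemLp (pointGenerator N c f) 2 P →
      ∃ hf : f ∈ L.domain, L ⟨f, hf⟩ =ᵐ[P] pointGenerator N c f := fun f hf hLf => by
    obtain ⟨F, rfl, hF⟩ := (LinearPMap.mem_graph_iff L).1
      (hL.mem_graph_of_memLp_pointGenerator hN.symm hc hcov hint hf hLf)
    refine ⟨F.2, ?_⟩
    change L F =ᵐ[P] _
    rw [hF]
    exact hLf.coeFn_toLp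
  refine ⟨fun f hf g hg z hz => integrable_energyDensity hc hf hg hz,
    ⟨hs, hcl, isMarkovianForm_energyForm hc⟩, isFormCore_boundedMeasurable hc hint, L, hL,
    fun L' hL' => hL.eq hs hL', hpoint, fun hsq f hfm ⟨C, hC⟩ => ?_⟩
  have hf2 : MemLp f 2 P :=
    MemLp.of_bound hfm.aestronglyMeasurable C (Eventually.of_forall hC)
  have hF := hf2.coeFn_toLp
  have hcur : ∀ z ∈ N, MemLp (fun ξ => c 0 z ξ * (f (z +ᵥ ξ) - f ξ)) 2 P := fun z hz => by
    have hcz : MemLp (c 0 z) 2 P :=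
      (memLp_two_iff_integrable_sq (hc.measurable 0 z).aestronglyMeasurable).2 (hsq z hz)
    refine (hcz.const_mul (2 * C)).of_le ((hc.measurable 0 z).aestronglyMeasurable.mul
      (aestronglyMeasurable_gradient hfm.aestronglyMeasurable z))
      (Eventually.of_forall fun ξ => ?_)
    have h1 := abs_sub (f (z +ᵥ ξ)) (f ξ)
    have h2 : |f (z +ᵥ ξ) - f ξ| ≤ 2 * C := by linarith [hC ξ, hC (z +ᵥ ξ)]
    rw [norm_mul, norm_mul, mul_comm, Real.norm_eq_abs, Real.norm_eq_abs (2 * C)]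
    exact mul_le_mul_of_nonneg_right (h2.trans (le_abs_self _)) (norm_nonneg _)
  have hcurF : ∀ z, (fun ξ => c 0 z ξ * (f (z +ᵥ ξ) - f ξ)) =ᵐ[P]
      fun ξ => c 0 z ξ * (hf2.toLp f (z +ᵥ ξ) - hf2.toLp f ξ) := fun z => by
    filter_upwards [hF, ae_vadd hF z] with ξ h1 h2
    rw [h1, h2]
  have hgenF : pointGenerator N c (hf2.toLp f) =ᵐ[P] pointGenerator N c f := by
    filter_upwards [(Finset.eventually_all N).2 fun z _ => hcurF z] with ξ h
    exact Finset.sum_congr rfl fun z hz => (h z hz).symm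
  have hgen2 : MemLp (pointGenerator N c (hf2.toLp f)) 2 P :=
    (memLp_congr_ae hgenF).2 (memLp_finsetSum N hcur)
  obtain ⟨hmem, hLF⟩ := hpoint (hf2.toLp f)
    (fun z hz => ((hcur z hz).integrable one_le_two).congr (hcurF z)) hgen2
  exact ⟨⟨_, hmem⟩, hF, hLF.trans hgenF⟩
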